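/- Let $\mathbf R^+=[0,\infty[$. Let $S$ be the set of nonnegative real sequences (families) $\omega=(\omega_i)$ with $\sum_i\omega_i=1$, and let $O$ be the set of positive (semidefinite) trace-class operators $\omega$ with trace $1$ on a separable complex Hilbert space $\mathcal H$; for $\omega\in O$ let $(\omega_i)$ denote the nonzero eigenvalues of $\omega$, repeated according to multiplicity. In both cases put $$\mathrm{entropy}(\omega)=-\sum_i\omega_i\ln\omega_i\in[0,+\infty]\qquad(0\ln 0=0).$$ Write $\|\cdot\|_1$, $\|\cdot\|_\infty$ for the norms of $\ell_1$ and $\ell_\infty$ (real or complex) in the case $S$, and for the trace norm and the operator norm in the case $O$. Let $U(\omega)\subset\mathbf R^+\times\mathbf R^+$ be the set of pairs $(r_1,r_\infty)$ such that, for members $a,b$ of the $\|\cdot\|_1$-Banach space with $a-b=\omega$, the open $\|\cdot\|_1$-ball of radius $r_1$ centered at $a$ and the open $\|\cdot\|_\infty$-ball of radius $r_\infty$ centered at $b$ do not intersect. Let $\partial U(\omega)$ be its boundary relative to $\mathbf R^+\times\mathbf R^+$. Then, for every $\omega$ in $S$ or $O$: (i) For $0<r_1<1$, a point $(r_1,r_\infty)$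 belongs to $\partial U(\omega)$ if and only if $$(1)\qquad r_1=\sum_i\max(0,\omega_i-r_\infty),$$ and for each such $r_1$ there is exactly one such $r_\infty=F(r_1)$. (ii) With $\int_{\partial U(\omega)}\ln(r_\infty)\,dr_1:=\int_0^1\ln F(r_1)\,dr_1\in[-\infty,0]$ (the integral along this curve), $$(2)\qquad \mathrm{entropy}(\omega)=-\int_{\partial U(\omega)}\ln(r_\infty)\,dr_1-1$$ as an identity in $[-\infty,+\infty]$; in particular, one side is $+\infty$ if and only if the other is. (iii) Let $a>b\ge 0$ be consecutive among the distinct values of the $\omega_i$, where $0$ always counts as a value. Let $n$ be the number of indices $i$ with $\omega_i\ge a$, and let $r_1'=\sum_i\max(0,\omega_i-a)$, $r_1''=\sum_i\max(0,\omega_i-b)$. Then $r_1'<r_1''$, $F(r_1)=a-(r_1-r_1')/n$ for $r_1'<r_1<r_1''$, the function $\ln F$ is integrable over $[r_1',r_1'']$, and $$-\int_{r_1'}^{r_1''}\ln F(r_1)\,dr_1=n\,[\,b\ln b-a\ln a\,]+(r_1''-r_1')\ \ge 0 .$$ Moreover $-\int_{\partial U(\omega)}\ln(r_\infty)\,dr_1$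 is the sum, in $[0,+\infty]$, of these contributions over all such pairs $(a,b)$. -/

import Mathlib

open MeasureTheory Set
open scoped NNReal ENNReal InnerProductSpace

noncomputable section

namespace EntropyNote

/-! ### Families of nonnegative numbers -/

/-- `-∑ ω_i ln ω_i`, an element of `[0, ∞]`. It is used only for families with values in `[0, 1]`,
for which every term `Real.negMulLog (ω i) = -(ω i) * ln (ω i)` is nonnegative (and is `0` when
`ω i = 0`). -/
def entropy {ι : Type*} (ω : ι → ℝ) : ℝ≥0∞ :=
  ∑' i, ENNReal.ofReal (Real.negMulLog (ω i))

/-- `∑ max(0, ω_i - t)`. -/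
def excess {ι : Type*} (ω : ι → ℝ) (t : ℝ) : ℝ :=
  ∑' i, max 0 (ω i - t)

/-- The number of indices `i` with `ω_i ≥ a`. -/
def countGE {ι : Type*} (ω : ι → ℝ) (a : ℝ) : ℕ :=
  Set.ncard {i | a ≤ ω i}

/-- The pairs `(a, b)`, `a > b ≥ 0`, of consecutive distinct values of the family `ω`; here `0`
always counts as a value (so that the last piece, which ends on the axis, is included when only
finitely many `ω_i` are nonzero). -/
def consecutiveValues {ι : Type*} (ω : ι → ℝ) : Set (ℝ × ℝ) :=
  {p | p.1 ∈ range ω ∧ (p.2 = 0 ∨ p.2 ∈ range ω) ∧ 0 ≤ p.2 ∧ p.2 < p.1 ∧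
    ∀ i, ω i ∉ Ioo p.2 p.1}

/-- `n [b ln b - a ln a] + (r'' - r')`, where `n` is the number of `ω_i`'s that are `≥ a`,
and `r'`, `r''` are the values of `∑ max(0, ω_i - t)` at `t = a` and `t = b`. -/
def contribution {ι : Type*} (ω : ι → ℝ) (a b : ℝ) : ℝ :=
  countGE ω a * (b * Real.log b - a * Real.log a) + (excess ω b - excess ω a)

/-! ### The boundary of a subset of the quadrant and integration along it -/

/-- The height `r_∞` of the boundary `∂U` (relative to the quadrant) above the abscissa `r`. -/
def boundaryHeight (U : Set (ℝ≥0 × ℝ≥0)) (r : ℝ) : ℝ :=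
  ((sSup {t : ℝ≥0 | (Real.toNNReal r, t) ∈ frontier U} : ℝ≥0) : ℝ)

/-- The integral over `s` of a real function as an extended real number:
the integral of the positive part minus the integral of the negative part. -/
def extIntegral (s : Set ℝ) (f : ℝ → ℝ) : EReal :=
  ((∫⁻ r in s, ENNReal.ofReal (f r) : ℝ≥0∞) : EReal) -
    ((∫⁻ r in s, ENNReal.ofReal (-f r) : ℝ≥0∞) : EReal)

/-- `∫_{∂U} ln(r_∞) dr_1`, along the part of `∂U` that lies over `0 < r_1 < 1`. -/
def boundaryLogIntegral (U : Set (ℝ≥0 × ℝ≥0)) : EReal :=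
  extIntegral (Ioo 0 1) (fun r => Real.log (boundaryHeight U r))

/-! ### Sequences -/

/-- `(r_1, r_∞) ∈ U(ω)` iff for `a, b ∈ ℓ_1` with difference `ω` the open `‖·‖_1`-ball of radius
`r_1` around `a` and the open `‖·‖_∞`-ball of radius `r_∞` around `b` do not intersect. -/
def seqU (𝕜 : Type*) [RCLike 𝕜] {ι : Type*} (ω : ι → ℝ) : Set (ℝ≥0 × ℝ≥0) :=
  {p | ∀ a b : lp (fun _ : ι => 𝕜) 1, (∀ i, a i - b i = ((ω i : ℝ) : 𝕜)) →
    Disjoint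
      (lp.linearMapOfLE 𝕜 (fun _ : ι => 𝕜) (le_top : (1 : ℝ≥0∞) ≤ ∞) '' Metric.ball a (p.1 : ℝ))
      (Metric.ball (lp.linearMapOfLE 𝕜 (fun _ : ι => 𝕜) (le_top : (1 : ℝ≥0∞) ≤ ∞) b) (p.2 : ℝ))}

/-! ### Operators -/

section Operators

variable {H : Type*} [NormedAddCommGroup H] [InnerProductSpace ℂ H] [CompleteSpace H]

/-- A Hilbert basis of `H`, as a set of vectors. -/
def basisSet (H : Type*) [NormedAddCommGroup H] [InnerProductSpace ℂ H] [CompleteSpace H] :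
    Set H :=
  (exists_hilbertBasis ℂ H).choose

/-- A Hilbert basis of `H` (the trace and the trace norm do not depend on the choice). -/
def basis (H : Type*) [NormedAddCommGroup H] [InnerProductSpace ℂ H] [CompleteSpace H] :
    HilbertBasis (basisSet H) ℂ H :=
  (exists_hilbertBasis ℂ H).choose_spec.choose

/-- The trace norm `‖T‖_1 = tr |T|`, `|T| = (T* T)^{1/2}`, an element of `[0, ∞]`. -/
def traceNorm (T : H →L[ℂ] H) : ℝ≥0∞ :=
  ∑' i, ENNReal.ofReal (RCLike.re ⟪basis H i, CFC.abs T (basis H i)⟫_ℂ)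

def IsTraceClass (T : H →L[ℂ] H) : Prop :=
  traceNorm T < ∞

/-- The trace of a trace-class operator. -/
def trace (T : H →L[ℂ] H) : ℂ :=
  ∑' i, ⟪basis H i, T (basis H i)⟫_ℂ

/-- The set `O` of positive trace-class operators of trace `1`. -/
def densityOperators (H : Type*) [NormedAddCommGroup H] [InnerProductSpace ℂ H]
    [CompleteSpace H] : Set (H →L[ℂ] H) :=
  {T | IsTraceClass T ∧ T.IsPositive ∧ trace T = 1}

/-- Indices for the nonzero real eigenvalues of `T`, each repeated according to its multiplicity
(the dimension of its eigenspace, which is finite for a trace-class operator). -/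
def EigenIndex (T : H →L[ℂ] H) : Type :=
  Σ μ : {μ : ℝ // μ ≠ 0},
    Fin (Module.finrank ℂ (Module.End.eigenspace (T : H →ₗ[ℂ] H) ((μ : ℝ) : ℂ)))

/-- The family of the nonzero eigenvalues of a self-adjoint operator, with multiplicity
(the eigenvalue `0` contributes nothing to any of the sums considered here). -/
def eigenvalues (T : H →L[ℂ] H) : EigenIndex T → ℝ :=
  fun k => (k.1 : ℝ)

/-- The open `‖·‖_1`-ball around `A` in the space of trace-class operators. -/
def traceBall (A : H →L[ℂ] H) (r : ℝ≥0) : Set (H →L[ℂ] H) :=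
  {X | IsTraceClass X ∧ traceNorm (X - A) < (r : ℝ≥0∞)}

/-- `(r_1, r_∞) ∈ U(T)` iff for trace-class `A, B` with difference `T` the open `‖·‖_1`-ball of
radius `r_1` around `A` and the open ball of radius `r_∞` around `B` for the operator norm do not
intersect. -/
def opU (T : H →L[ℂ] H) : Set (ℝ≥0 × ℝ≥0) :=
  {p | ∀ A B : H →L[ℂ] H, IsTraceClass A → IsTraceClass B → A - B = T →
    Disjoint (traceBall A p.1) (Metric.ball B (p.2 : ℝ))}

end Operators

end EntropyNote

end

open EntropyNote

namespace EntropyNote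

/-! ### The function `t ↦ ∑ max(0, ω_i - t)` -/

section Excess

variable {ι : Type*} {ω : ι → ℝ}

/-! Write E(t) = ∑ max(0, ω_i - t). Everything rests on the description U = {t = 0} ∪ {r ≤ E(t)}
(`mem_seqU_iff`, `mem_opU_iff`). If x lies in both balls, then |(x - b)_i| ≤ t and ω = (x - b) - (x
- a) force |(x - a)_i| ≥ ω_i - t, so ‖x - a‖_1 ≥ E(t). Conversely, a = ω, b = 0 and the truncation x
= min(ω, s), with s slightly below t, give intersecting balls. For operators the same argument runs
on diagonal entries in an eigenbasis of T, because these are summable with sum at most the trace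
norm (`tsum_enorm_inner_apply_le_traceNorm`).

E is continuous on [0, ∞), strictly decreasing while positive, E(0) = 1 and E(1) = 0. Hence over 0 <
r < 1 the boundary is the graph of the inverse F of E. Since -ln F(r) = ∫_{F(r)}^1 ds/s, and F(r) <
s iff E(s) < r, Tonelli gives -∫ ln F = ∫_0^1 (1 - E(s))/s ds. Now 1 - E(s) = ∑ min(ω_i, s) and
∫_0^1 min(x, s)/s ds = x - x ln x, so the total is 1 + entropy, finite or not
(`lintegral_neg_log_boundaryHeight`).

Between consecutive values of ω, E is affine with slope -n. So F is affine on the corresponding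
r-interval, its logarithm integrates explicitly, and these intervals tile (0, 1) up to a null set.
-/

theorem summable_excess (h0 : ∀ i, 0 ≤ ω i) (hs : Summable ω) {t : ℝ} (ht : 0 ≤ t) :
    Summable fun i => max 0 (ω i - t) :=
  hs.of_nonneg_of_le (fun _ => le_max_left _ _) fun i => max_le (h0 i) (by linarith)

theorem excess_nonneg (ω : ι → ℝ) (t : ℝ) : 0 ≤ excess ω t :=
  tsum_nonneg fun _ => le_max_left _ _

theorem excess_zero (h0 : ∀ i, 0 ≤ ω i) (h1 : HasSum ω 1) : excess ω 0 = 1 := by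
  rw [← h1.tsum_eq]
  exact tsum_congr fun i => by simp [h0 i]

theorem excess_antitone (h0 : ∀ i, 0 ≤ ω i) (hs : Summable ω) {s t : ℝ} (hs0 : 0 ≤ s)
    (hst : s ≤ t) : excess ω t ≤ excess ω s :=
  (summable_excess h0 hs (hs0.trans hst)).tsum_le_tsum
    (fun _ => max_le_max le_rfl (by linarith)) (summable_excess h0 hs hs0)

theorem excess_lt_excess (h0 : ∀ i, 0 ≤ ω i) (hs : Summable ω) {s t : ℝ} (hs0 : 0 ≤ s)
    (hst : s < t) (hpos : 0 < excess ω s) : excess ω t < excess ω s := by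
  obtain ⟨i, hi⟩ : ∃ i, s < ω i := by
    by_contra! h
    refine hpos.ne' ?_
    exact (tsum_congr fun i => max_eq_left (sub_nonpos.2 (h i))).trans tsum_zero
  refine Summable.tsum_lt_tsum (i := i) (fun _ => max_le_max le_rfl (by linarith)) ?_
    (summable_excess h0 hs (hs0.trans hst.le)) (summable_excess h0 hs hs0)
  rw [max_eq_right (by linarith : 0 ≤ ω i - s)]
  exact max_lt (by linarith) (by linarith)

theorem excess_injOn (h0 : ∀ i, 0 ≤ ω i) (hs : Summable ω) {s t : ℝ} (hs0 : 0 ≤ s)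
    (ht0 : 0 ≤ t) (hpos : 0 < excess ω s) (h : excess ω s = excess ω t) : s = t := by
  rcases lt_trichotomy s t with hst | hst | hst
  · exact absurd (excess_lt_excess h0 hs hs0 hst hpos) (by simp [h])
  · exact hst
  · exact absurd (excess_lt_excess h0 hs ht0 hst (h ▸ hpos)) (by simp [h])

theorem lt_of_excess_lt (h0 : ∀ i, 0 ≤ ω i) (hs : Summable ω) {s t : ℝ} (ht0 : 0 ≤ t)
    (h : excess ω t < excess ω s) : s < t := by
  by_contra! hts
  exact absurd (excess_antitone h0 hs ht0 hts) (not_le.2 h)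

/-- The terms are dominated by ω_i uniformly in t ≥ 0, so the series converges uniformly. For t < 0
the series diverges when the index set is infinite, hence the restriction to `ℝ≥0`. -/
theorem continuous_excess (h0 : ∀ i, 0 ≤ ω i) (hs : Summable ω) :
    Continuous fun t : ℝ≥0 => excess ω t := by
  refine continuous_tsum (fun i => by fun_prop) hs fun i t => ?_
  rw [Real.norm_of_nonneg (le_max_left _ _)]
  exact max_le (h0 i) (by linarith [t.2, (show (0 : ℝ) ≤ t from t.2)])

theorem le_one_of_hasSum_one (h0 : ∀ i, 0 ≤ ω i) (h1 : HasSum ω 1) (i : ι) : ω i ≤ 1 :=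
  le_hasSum h1 i fun j _ => h0 j

theorem excess_one (h0 : ∀ i, 0 ≤ ω i) (h1 : HasSum ω 1) : excess ω 1 = 0 := by
  exact (tsum_congr fun i => max_eq_left (sub_nonpos.2 (le_one_of_hasSum_one h0 h1 i))).trans tsum_zero

theorem finite_setOf_le (hs : Summable ω) {a : ℝ} (ha : 0 < a) : {i | a ≤ ω i}.Finite := by
  have := hs.tendsto_cofinite_zero.eventually (gt_mem_nhds ha)
  simpa [Filter.eventually_cofinite] using this

theorem exists_excess_eq (h0 : ∀ i, 0 ≤ ω i) (h1 : HasSum ω 1) {r : ℝ} (hr : r ∈ Ioo (0 : ℝ) 1) :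
    ∃ t ∈ Ioo (0 : ℝ) 1, excess ω t = r := by
  have hc := continuous_excess h0 h1.summable
  have := intermediate_value_Icc' (zero_le_one' ℝ≥0) hc.continuousOn
  simp only [NNReal.coe_one, NNReal.coe_zero, excess_zero h0 h1, excess_one h0 h1] at this
  obtain ⟨t, -, rfl⟩ := this (Ioo_subset_Icc_self hr)
  refine ⟨t, ⟨lt_of_excess_lt h0 h1.summable t.2 ?_, ?_⟩, rfl⟩
  · simpa [excess_zero h0 h1] using hr.2
  · by_contra! h
    have := excess_antitone h0 h1.summable zero_le_one h
    rw [excess_one h0 h1] at this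
    exact absurd hr.1 (by linarith)

end Excess

/-! ### The boundary curve -/

section Curve

variable {ι : Type*} {ω : ι → ℝ} {U : Set (ℝ≥0 × ℝ≥0)}

/-- U is closed, and r < E(t) is an open condition, so a boundary point satisfies equality; from a
point of the curve, any increase of r leaves U. As E(0) = 1, the axis t = 0 adds nothing to U where
r < 1. -/
theorem mem_frontier_iff (h0 : ∀ i, 0 ≤ ω i) (h1 : HasSum ω 1)
    (hU : ∀ r t : ℝ≥0, (r, t) ∈ U ↔ t = 0 ∨ (r : ℝ) ≤ excess ω t) {r t : ℝ≥0} (hr1 : r < 1) :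
    (r, t) ∈ frontier U ↔ (r : ℝ) = excess ω t := by
  have hc := continuous_excess h0 h1.summable
  have hUeq : U = {p : ℝ≥0 × ℝ≥0 | p.2 = 0} ∪ {p | (p.1 : ℝ) ≤ excess ω p.2} := by
    ext ⟨r, t⟩
    exact hU r t
  have hclosed : IsClosed U := by
    rw [hUeq]
    exact (isClosed_eq continuous_snd continuous_const).union
      (isClosed_le (by fun_prop) (hc.comp continuous_snd))
  have key : ∀ r' : ℝ≥0, r' < 1 → ((r', t) ∈ U ↔ (r' : ℝ) ≤ excess ω t) := fun r' hr' => by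
    rw [hU, or_iff_right_of_imp]
    rintro rfl
    rw [NNReal.coe_zero, excess_zero h0 h1]
    exact_mod_cast hr'.le
  rw [hclosed.frontier_eq, mem_sdiff, key r hr1]
  constructor
  · rintro ⟨hle, hint⟩
    refine le_antisymm hle (not_lt.1 fun hlt => hint ?_)
    refine mem_interior.2 ⟨{p | (p.1 : ℝ) < excess ω p.2}, fun p hp => ?_,
      isOpen_lt (by fun_prop) (hc.comp continuous_snd), hlt⟩
    rw [hUeq]
    exact Or.inr (show (p.1 : ℝ) ≤ excess ω p.2 from le_of_lt hp)
  · intro heq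
    refine ⟨heq.le, fun hint => ?_⟩
    have hnear : ∀ᶠ r' in nhds r, (r', t) ∈ U :=
      (Continuous.prodMk_left t).continuousAt.eventually
        (mem_interior_iff_mem_nhds.1 hint)
    -- Only r' < 1 is allowed, so that the axis part of U cannot interfere when t = 0.
    have h2 : ∀ᶠ r' in nhdsWithin r (Ioi r), (r', t) ∈ U ∧ r' < 1 ∧ r < r' := by
      filter_upwards [hnear.filter_mono nhdsWithin_le_nhds,
        (gt_mem_nhds hr1 : ∀ᶠ x in nhds r, x < 1).filter_mono nhdsWithin_le_nhds,
        self_mem_nhdsWithin] with x h1 h2 h3 using ⟨h1, h2, h3⟩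
    have : (nhdsWithin r (Ioi r)).NeBot := nhdsGT_neBot_of_exists_gt ⟨1, hr1⟩
    obtain ⟨r', h3, h4, h5⟩ := h2.exists
    rw [key r' h4, ← heq] at h3
    exact absurd h5 (not_lt.2 (by exact_mod_cast h3))

theorem boundaryHeight_eq (h0 : ∀ i, 0 ≤ ω i) (h1 : HasSum ω 1)
    (hU : ∀ r t : ℝ≥0, (r, t) ∈ U ↔ t = 0 ∨ (r : ℝ) ≤ excess ω t) {r t : ℝ}
    (hr : r ∈ Ioo (0 : ℝ) 1) (ht : 0 ≤ t) (hrt : excess ω t = r) : boundaryHeight U r = t := by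
  lift t to ℝ≥0 using ht
  have hset : {s : ℝ≥0 | (Real.toNNReal r, s) ∈ frontier U} = {t} := by
    ext s
    rw [mem_ofPred_eq, mem_frontier_iff h0 h1 hU (by simpa using hr.2),
      Real.coe_toNNReal _ hr.1.le, mem_singleton_iff]
    constructor
    · intro h
      exact NNReal.eq (excess_injOn h0 h1.summable s.2 t.2 (h ▸ hr.1) (h ▸ hrt.symm))
    · rintro rfl
      exact hrt.symm
  rw [boundaryHeight, hset, csSup_singleton]

theorem existsUnique_mem_frontier (h0 : ∀ i, 0 ≤ ω i) (h1 : HasSum ω 1)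
    (hU : ∀ r t : ℝ≥0, (r, t) ∈ U ↔ t = 0 ∨ (r : ℝ) ≤ excess ω t) {r : ℝ≥0} (hr0 : 0 < r)
    (hr1 : r < 1) : ∃! t : ℝ≥0, (r, t) ∈ frontier U := by
  obtain ⟨t, ht, hrt⟩ := exists_excess_eq h0 h1 (r := r) ⟨hr0, by exact_mod_cast hr1⟩
  lift t to ℝ≥0 using ht.1.le
  refine ⟨t, (mem_frontier_iff h0 h1 hU hr1).2 hrt.symm, fun s hs => ?_⟩
  have hs := (mem_frontier_iff h0 h1 hU hr1).1 hs
  exact NNReal.eq (excess_injOn h0 h1.summable s.2 t.2 (hs ▸ hr0) (hs.symm.trans hrt.symm))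

end Curve

/-! ### The affine pieces of the curve -/

section Pieces

variable {ι : Type*} {ω : ι → ℝ} {U : Set (ℝ≥0 × ℝ≥0)}

theorem countGE_pos (hs : Summable ω) {a : ℝ} (ha : 0 < a) (hmem : a ∈ range ω) :
    0 < countGE ω a := by
  obtain ⟨i, hi⟩ := hmem
  exact (Set.ncard_pos (finite_setOf_le hs ha)).2 ⟨i, hi.ge⟩

/-- On a gap between consecutive values the active terms are exactly those with ω_i ≥ a, and each
grows at unit rate as t decreases. -/
theorem excess_eq_of_mem_Icc (h0 : ∀ i, 0 ≤ ω i) (hs : Summable ω) {p : ℝ × ℝ}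
    (hp : p ∈ consecutiveValues ω) {t : ℝ} (ht : t ∈ Icc p.2 p.1) :
    excess ω t = excess ω p.1 + countGE ω p.1 * (p.1 - t) := by
  obtain ⟨-, -, hb, hab, hno⟩ := hp
  have ha : 0 < p.1 := hb.trans_lt hab
  have hfin := finite_setOf_le hs ha
  have hsum : ∑' i, (max 0 (ω i - t) - max 0 (ω i - p.1)) = countGE ω p.1 * (p.1 - t) := by
    rw [tsum_eq_sum (s := hfin.toFinset), Finset.sum_congr rfl (g := fun _ => p.1 - t),
      Finset.sum_const, countGE, Set.ncard_eq_toFinset_card _ hfin, nsmul_eq_mul]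
    · intro i hi
      have hi : p.1 ≤ ω i := by simpa using hi
      rw [max_eq_right (by linarith [ht.2]), max_eq_right (by linarith)]
      ring
    · intro i hi
      have hi : ω i < p.1 := by simpa using hi
      -- No value lies inside the gap, so these terms vanish both at t and at a.
      have h2 : ω i ≤ p.2 := by
        by_contra! h
        exact hno i ⟨h, hi⟩
      rw [max_eq_left (by linarith [ht.1]), max_eq_left (by linarith), sub_zero]
  rw [← hsum, (summable_excess h0 hs (hb.trans ht.1)).tsum_sub (summable_excess h0 hs ha.le)]
  simp only [excess]
  ring

theorem excess_fst_lt_excess_snd (h0 : ∀ i, 0 ≤ ω i) (hs : Summable ω) {p : ℝ × ℝ}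
    (hp : p ∈ consecutiveValues ω) : excess ω p.1 < excess ω p.2 := by
  have hn := countGE_pos hs (hp.2.2.1.trans_lt hp.2.2.2.1) hp.1
  rw [excess_eq_of_mem_Icc h0 hs hp (left_mem_Icc.2 hp.2.2.2.1.le)]
  have : (0 : ℝ) < countGE ω p.1 * (p.1 - p.2) :=
    mul_pos (by exact_mod_cast hn) (sub_pos.2 hp.2.2.2.1)
  linarith

theorem boundaryHeight_eq_of_mem_Ioo (h0 : ∀ i, 0 ≤ ω i) (h1 : HasSum ω 1)
    (hU : ∀ r t : ℝ≥0, (r, t) ∈ U ↔ t = 0 ∨ (r : ℝ) ≤ excess ω t) {p : ℝ × ℝ}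
    (hp : p ∈ consecutiveValues ω) {r : ℝ} (hr : r ∈ Ioo (excess ω p.1) (excess ω p.2)) :
    boundaryHeight U r = p.1 - (r - excess ω p.1) / countGE ω p.1 := by
  have hs := h1.summable
  have hn : (0 : ℝ) < countGE ω p.1 := by
    exact_mod_cast countGE_pos hs (hp.2.2.1.trans_lt hp.2.2.2.1) hp.1
  have hb := excess_eq_of_mem_Icc h0 hs hp (left_mem_Icc.2 hp.2.2.2.1.le)
  have hlo : 0 < (r - excess ω p.1) / countGE ω p.1 := div_pos (sub_pos.2 hr.1) hn
  have hhi : (r - excess ω p.1) / countGE ω p.1 < p.1 - p.2 := by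
    rw [div_lt_iff₀ hn]
    linarith [hr.2]
  have hE0 := excess_antitone h0 hs le_rfl hp.2.2.1
  rw [excess_zero h0 h1] at hE0
  refine boundaryHeight_eq h0 h1 hU ⟨(excess_nonneg ω _).trans_lt hr.1, hr.2.trans_le hE0⟩
    (by linarith [hp.2.2.1]) ?_
  rw [excess_eq_of_mem_Icc h0 hs hp ⟨by linarith, by linarith⟩]
  field_simp
  ring

/-- The logarithm is integrable even across 0, which covers the last piece, where F tends to b = 0.
-/
theorem intervalIntegrable_log_sub_div (a c : ℝ) {n : ℝ} (hn : n ≠ 0) (x y : ℝ) :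
    IntervalIntegrable (fun r => Real.log (a - (r - c) / n)) volume x y := by
  have h : ∀ z, (a + c / n - (a + c / n - n⁻¹ * z)) / n⁻¹ = z := fun z => by
    field_simp
    ring
  have := ((intervalIntegral.intervalIntegrable_log' (a := a + c / n - n⁻¹ * x)
    (b := a + c / n - n⁻¹ * y)).comp_sub_left (a + c / n)).comp_mul_left (c := n⁻¹)
  rw [h, h] at this
  refine this.congr_uIoo fun r _ => ?_
  simp only
  congr 1
  ring

theorem integral_log_sub_div (a c : ℝ) {n : ℝ} (hn : n ≠ 0) (x y : ℝ) :
    ∫ r in x..y, Real.log (a - (r - c) / n) =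
      n * ∫ u in (a - (y - c) / n)..(a - (x - c) / n), Real.log u := by
  have h : ∀ r, a - (r - c) / n = (a + c / n) - r / n := fun r => by ring
  simp only [h]
  rw [intervalIntegral.integral_comp_sub_div Real.log hn, smul_eq_mul]

theorem log_boundaryHeight_eqOn (h0 : ∀ i, 0 ≤ ω i) (h1 : HasSum ω 1)
    (hU : ∀ r t : ℝ≥0, (r, t) ∈ U ↔ t = 0 ∨ (r : ℝ) ≤ excess ω t) {p : ℝ × ℝ}
    (hp : p ∈ consecutiveValues ω) :
    EqOn (fun r => Real.log (boundaryHeight U r))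
      (fun r => Real.log (p.1 - (r - excess ω p.1) / countGE ω p.1))
      (uIoo (excess ω p.1) (excess ω p.2)) := by
  rw [uIoo_of_le (excess_fst_lt_excess_snd h0 h1.summable hp).le]
  exact fun r hr => congrArg Real.log (boundaryHeight_eq_of_mem_Ioo h0 h1 hU hp hr)

theorem intervalIntegrable_log_boundaryHeight (h0 : ∀ i, 0 ≤ ω i) (h1 : HasSum ω 1)
    (hU : ∀ r t : ℝ≥0, (r, t) ∈ U ↔ t = 0 ∨ (r : ℝ) ≤ excess ω t) {p : ℝ × ℝ}
    (hp : p ∈ consecutiveValues ω) :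
    IntervalIntegrable (fun r => Real.log (boundaryHeight U r)) volume
      (excess ω p.1) (excess ω p.2) := by
  have hn := (countGE_pos h1.summable (hp.2.2.1.trans_lt hp.2.2.2.1) hp.1).ne'
  exact (intervalIntegrable_log_sub_div p.1 (excess ω p.1) (Nat.cast_ne_zero.2 hn) _ _).congr_uIoo
    (log_boundaryHeight_eqOn h0 h1 hU hp).symm

/-- Substituting u = F(r) gives n ∫_b^a ln u du = n (a ln a - b ln b - (a - b)), and n (a - b) is
the length of the r-interval. -/
theorem neg_integral_log_boundaryHeight (h0 : ∀ i, 0 ≤ ω i) (h1 : HasSum ω 1)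
    (hU : ∀ r t : ℝ≥0, (r, t) ∈ U ↔ t = 0 ∨ (r : ℝ) ≤ excess ω t) {p : ℝ × ℝ}
    (hp : p ∈ consecutiveValues ω) :
    -(∫ r in (excess ω p.1)..(excess ω p.2), Real.log (boundaryHeight U r)) =
      contribution ω p.1 p.2 := by
  have hn : (countGE ω p.1 : ℝ) ≠ 0 :=
    Nat.cast_ne_zero.2 (countGE_pos h1.summable (hp.2.2.1.trans_lt hp.2.2.2.1) hp.1).ne'
  have hb := excess_eq_of_mem_Icc h0 h1.summable hp (left_mem_Icc.2 hp.2.2.2.1.le)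
  rw [intervalIntegral.integral_congr_uIoo (log_boundaryHeight_eqOn h0 h1 hU hp),
    integral_log_sub_div _ _ hn, integral_log, contribution]
  have e1 : p.1 - (excess ω p.1 - excess ω p.1) / countGE ω p.1 = p.1 := by simp
  have e2 : p.1 - (excess ω p.2 - excess ω p.1) / countGE ω p.1 = p.2 := by
    rw [hb]
    field_simp
    ring
  rw [e1, e2, hb]
  ring

theorem log_boundaryHeight_nonpos (h0 : ∀ i, 0 ≤ ω i) (h1 : HasSum ω 1)
    (hU : ∀ r t : ℝ≥0, (r, t) ∈ U ↔ t = 0 ∨ (r : ℝ) ≤ excess ω t) {r : ℝ}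
    (hr : r ∈ Ioo (0 : ℝ) 1) : Real.log (boundaryHeight U r) ≤ 0 := by
  obtain ⟨t, ht, hrt⟩ := exists_excess_eq h0 h1 hr
  rw [boundaryHeight_eq h0 h1 hU hr ht.1.le hrt]
  exact Real.log_nonpos ht.1.le ht.2.le

theorem Ioo_excess_subset (h0 : ∀ i, 0 ≤ ω i) (h1 : HasSum ω 1) {p : ℝ × ℝ}
    (hp : p ∈ consecutiveValues ω) :
    Ioo (excess ω p.1) (excess ω p.2) ⊆ Ioo 0 1 :=
  Ioo_subset_Ioo (excess_nonneg ω _)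
    ((excess_antitone h0 h1.summable le_rfl hp.2.2.1).trans_eq (excess_zero h0 h1))

theorem lintegral_neg_log_boundaryHeight_piece (h0 : ∀ i, 0 ≤ ω i) (h1 : HasSum ω 1)
    (hU : ∀ r t : ℝ≥0, (r, t) ∈ U ↔ t = 0 ∨ (r : ℝ) ≤ excess ω t) {p : ℝ × ℝ}
    (hp : p ∈ consecutiveValues ω) :
    ∫⁻ r in Ioc (excess ω p.1) (excess ω p.2),
      ENNReal.ofReal (-Real.log (boundaryHeight U r)) =
      ENNReal.ofReal (contribution ω p.1 p.2) := by
  have hlt := excess_fst_lt_excess_snd h0 h1.summable hp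
  have hint := (intervalIntegrable_iff_integrableOn_Ioo_of_le hlt.le).1
    (intervalIntegrable_log_boundaryHeight h0 h1 hU hp)
  rw [← neg_integral_log_boundaryHeight h0 h1 hU hp, intervalIntegral.integral_of_le hlt.le,
    integral_Ioc_eq_integral_Ioo, ← integral_neg, ← restrict_Ioo_eq_restrict_Ioc,
    ofReal_integral_eq_lintegral_ofReal (f := fun r => -Real.log (boundaryHeight U r)) hint.neg]
  filter_upwards [ae_restrict_mem measurableSet_Ioo] with r hr
  exact neg_nonneg.2 (log_boundaryHeight_nonpos h0 h1 hU (Ioo_excess_subset h0 h1 hp hr))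

theorem contribution_nonneg (h0 : ∀ i, 0 ≤ ω i) (h1 : HasSum ω 1)
    (hU : ∀ r t : ℝ≥0, (r, t) ∈ U ↔ t = 0 ∨ (r : ℝ) ≤ excess ω t) {p : ℝ × ℝ}
    (hp : p ∈ consecutiveValues ω) : 0 ≤ contribution ω p.1 p.2 := by
  rw [← neg_integral_log_boundaryHeight h0 h1 hU hp, intervalIntegral.integral_of_le
    (excess_fst_lt_excess_snd h0 h1.summable hp).le, integral_Ioc_eq_integral_Ioo, neg_nonneg]
  exact setIntegral_nonpos measurableSet_Ioo fun r hr =>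
    log_boundaryHeight_nonpos h0 h1 hU (Ioo_excess_subset h0 h1 hp hr)

end Pieces

/-! ### Tiling of (0, 1) by the pieces -/

section Integral

variable {ι : Type*} {ω : ι → ℝ} {U : Set (ℝ≥0 × ℝ≥0)}

/-- Values of a summable family accumulate only at 0. Hence there is a least value above t, and a
greatest value in (0, t] unless there is none, in which case the lower end is 0. -/
theorem exists_consecutiveValues (h0 : ∀ i, 0 ≤ ω i) (hs : Summable ω) {t : ℝ} (ht : 0 < t)
    (hpos : 0 < excess ω t) : ∃ p ∈ consecutiveValues ω, t ∈ Ico p.2 p.1 := by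
  obtain ⟨i, hi⟩ : ∃ i, t < ω i := by
    by_contra! h
    exact hpos.ne' ((tsum_congr fun i => max_eq_left (sub_nonpos.2 (h i))).trans tsum_zero)
  obtain ⟨j, hj, hjmin⟩ := Set.exists_min_image {i | t < ω i} ω
    ((finite_setOf_le hs ht).subset fun i (hi : t < ω i) => hi.le) ⟨i, hi⟩
  by_cases hk : ∃ k, 0 < ω k ∧ ω k ≤ t
  · obtain ⟨k₀, hk₀, hk₀t⟩ := hk
    obtain ⟨k, hk, hkmax⟩ := Set.exists_max_image {i | ω k₀ ≤ ω i ∧ ω i ≤ t} ω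
      ((finite_setOf_le hs hk₀).subset fun i hi => hi.1) ⟨k₀, le_rfl, hk₀t⟩
    refine ⟨(ω j, ω k), ⟨⟨j, rfl⟩, Or.inr ⟨k, rfl⟩, h0 k, hk.2.trans_lt hj, fun l hl => ?_⟩,
      hk.2, hj⟩
    rcases le_or_gt (ω l) t with h | h
    · exact absurd (hkmax l ⟨hk.1.trans hl.1.le, h⟩) (not_le.2 hl.1)
    · exact absurd (hjmin l h) (not_le.2 hl.2)
  · push Not at hk
    refine ⟨(ω j, 0), ⟨⟨j, rfl⟩, Or.inl rfl, le_rfl, ht.trans hj, fun l hl => ?_⟩, ht.le, hj⟩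
    exact absurd (hjmin l (hk l hl.1)) (not_le.2 hl.2)

theorem consecutiveValues_eq_of_mem {p q : ℝ × ℝ} (hp : p ∈ consecutiveValues ω)
    (hq : q ∈ consecutiveValues ω) {t : ℝ} (htp : t ∈ Ico p.2 p.1) (htq : t ∈ Ico q.2 q.1) :
    p = q := by
  have key1 : ∀ p ∈ consecutiveValues ω, ∀ q ∈ consecutiveValues ω, t ∈ Ico p.2 p.1 →
      t ∈ Ico q.2 q.1 → q.1 ≤ p.1 := by
    intro p hp q hq htp htq
    by_contra! h
    obtain ⟨i, hi⟩ := hp.1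
    exact hq.2.2.2.2 i (hi ▸ ⟨htq.1.trans_lt htp.2, h⟩)
  have key2 : ∀ p ∈ consecutiveValues ω, ∀ q ∈ consecutiveValues ω, t ∈ Ico p.2 p.1 →
      t ∈ Ico q.2 q.1 → q.2 ≤ p.2 := by
    intro p hp q hq htp htq
    by_contra! h
    rcases hq.2.1 with h' | ⟨i, hi⟩
    · exact absurd hp.2.2.1 (not_le.2 (h' ▸ h))
    · exact hp.2.2.2.2 i (hi ▸ ⟨h, htq.1.trans_lt htp.2⟩)
  exact Prod.ext (le_antisymm (key1 q hq p hp htq htp) (key1 p hp q hq htp htq))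
    (le_antisymm (key2 q hq p hp htq htp) (key2 p hp q hq htp htq))

/-- A gap is determined by its upper end, a nonzero value of a family with countable support; the
index set itself may be uncountable. -/
theorem countable_consecutiveValues (hs : Summable ω) : (consecutiveValues ω).Countable := by
  refine Set.MapsTo.countable_of_injOn (f := Prod.fst) (t := ω '' Function.support ω) ?_ ?_
    (hs.countable_support.image ω)
  · intro p hp
    obtain ⟨i, hi⟩ := hp.1
    exact ⟨i, (hi.symm ▸ hp.2.2.1.trans_lt hp.2.2.2.1 : 0 < ω i).ne', hi⟩
  · intro p hp q hq (hpq : p.1 = q.1)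
    exact consecutiveValues_eq_of_mem (t := max p.2 q.2) hp hq
      ⟨le_max_left _ _, max_lt hp.2.2.2.1 (hpq ▸ hq.2.2.2.1)⟩
      ⟨le_max_right _ _, max_lt (hpq ▸ hp.2.2.2.1) hq.2.2.2.1⟩

theorem exists_mem_Ico_excess_eq (h0 : ∀ i, 0 ≤ ω i) (hs : Summable ω) {p : ℝ × ℝ}
    (hp : p ∈ consecutiveValues ω) {r : ℝ} (hr : r ∈ Ioc (excess ω p.1) (excess ω p.2)) :
    ∃ t ∈ Ico p.2 p.1, excess ω t = r := by
  have hn : (0 : ℝ) < countGE ω p.1 := by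
    exact_mod_cast countGE_pos hs (hp.2.2.1.trans_lt hp.2.2.2.1) hp.1
  have hb := excess_eq_of_mem_Icc h0 hs hp (left_mem_Icc.2 hp.2.2.2.1.le)
  have hlo : 0 < (r - excess ω p.1) / countGE ω p.1 := div_pos (sub_pos.2 hr.1) hn
  have hhi : (r - excess ω p.1) / countGE ω p.1 ≤ p.1 - p.2 := by
    rw [div_le_iff₀ hn]
    linarith [hr.2]
  refine ⟨p.1 - (r - excess ω p.1) / countGE ω p.1, ⟨by linarith, by linarith⟩, ?_⟩
  rw [excess_eq_of_mem_Icc h0 hs hp ⟨by linarith, by linarith⟩]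
  field_simp
  ring

theorem pairwise_disjoint_Ioc_excess (h0 : ∀ i, 0 ≤ ω i) (hs : Summable ω) :
    Pairwise (Function.onFun Disjoint fun p : consecutiveValues ω =>
      Ioc (excess ω p.1.1) (excess ω p.1.2)) := by
  intro p q hpq
  refine Set.disjoint_left.2 fun r hrp hrq => hpq (Subtype.ext ?_)
  obtain ⟨t, htp, ht⟩ := exists_mem_Ico_excess_eq h0 hs p.2 hrp
  obtain ⟨s, hsq, hsr⟩ := exists_mem_Ico_excess_eq h0 hs q.2 hrq
  have hst : t = s := excess_injOn h0 hs (p.2.2.2.1.trans htp.1) (q.2.2.2.1.trans hsq.1)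
    (ht ▸ (excess_nonneg ω _).trans_lt hrp.1) (ht.trans hsr.symm)
  exact consecutiveValues_eq_of_mem p.2 q.2 htp (hst ▸ hsq)

theorem Ioc_excess_subset (h0 : ∀ i, 0 ≤ ω i) (h1 : HasSum ω 1) {p : ℝ × ℝ}
    (hp : p ∈ consecutiveValues ω) :
    Ioc (excess ω p.1) (excess ω p.2) ⊆ Ioc 0 1 :=
  Ioc_subset_Ioc (excess_nonneg ω _)
    ((excess_antitone h0 h1.summable le_rfl hp.2.2.1).trans_eq (excess_zero h0 h1))

/-- The two sets can differ only at r = 1. -/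
theorem iUnion_Ioc_excess_ae_eq (h0 : ∀ i, 0 ≤ ω i) (h1 : HasSum ω 1) :
    (⋃ p : consecutiveValues ω, Ioc (excess ω p.1.1) (excess ω p.1.2)) =ᵐ[volume]
      Ioo (0 : ℝ) 1 := by
  have hs := h1.summable
  have hsub : Ioo (0 : ℝ) 1 ⊆
      ⋃ p : consecutiveValues ω, Ioc (excess ω p.1.1) (excess ω p.1.2) := by
    intro r hr
    obtain ⟨t, ht, rfl⟩ := exists_excess_eq h0 h1 hr
    obtain ⟨p, hp, htp⟩ := exists_consecutiveValues h0 hs ht.1 hr.1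
    exact mem_iUnion.2 ⟨⟨p, hp⟩, excess_lt_excess h0 hs ht.1.le htp.2 hr.1,
      excess_antitone h0 hs hp.2.2.1 htp.1⟩
  have hsub' : (⋃ p : consecutiveValues ω, Ioc (excess ω p.1.1) (excess ω p.1.2)) ⊆ Ioc 0 1 :=
    iUnion_subset fun p => Ioc_excess_subset h0 h1 p.2
  exact (hsub'.eventuallyLE.trans Ioo_ae_eq_Ioc.symm.le).antisymm hsub.eventuallyLE

theorem lintegral_neg_log_boundaryHeight_eq_tsum (h0 : ∀ i, 0 ≤ ω i) (h1 : HasSum ω 1)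
    (hU : ∀ r t : ℝ≥0, (r, t) ∈ U ↔ t = 0 ∨ (r : ℝ) ≤ excess ω t) :
    ∫⁻ r in Ioo 0 1, ENNReal.ofReal (-Real.log (boundaryHeight U r)) =
      ∑' p : consecutiveValues ω, ENNReal.ofReal (contribution ω p.1.1 p.1.2) := by
  have : Countable (consecutiveValues ω) := (countable_consecutiveValues h1.summable).to_subtype
  rw [← setLIntegral_congr (iUnion_Ioc_excess_ae_eq h0 h1),
    lintegral_iUnion (fun _ => measurableSet_Ioc) (pairwise_disjoint_Ioc_excess h0 h1.summable)]
  exact tsum_congr fun p => lintegral_neg_log_boundaryHeight_piece h0 h1 hU p.2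

/-! ### The entropy as an iterated integral -/

theorem lintegral_Ioo_inv {a b : ℝ} (ha : 0 < a) (hab : a ≤ b) :
    ∫⁻ s in Ioo a b, ENNReal.ofReal s⁻¹ = ENNReal.ofReal (Real.log (b / a)) := by
  rw [← integral_inv_of_pos ha (ha.trans_le hab), intervalIntegral.integral_of_le hab,
    integral_Ioc_eq_integral_Ioo, ofReal_integral_eq_lintegral_ofReal]
  · refine (intervalIntegrable_iff_integrableOn_Ioo_of_le hab).1 ?_
    refine intervalIntegral.intervalIntegrable_inv (fun x hx => ?_) continuousOn_id
    rw [uIcc_of_le hab] at hx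
    exact (ha.trans_le hx.1).ne'
  · filter_upwards [ae_restrict_mem measurableSet_Ioo] with s hs
    exact inv_nonneg.2 (ha.trans hs.1).le

/-- The integrand is 1 on (0, x] and x/s on (x, 1]. -/
theorem lintegral_min_div {x : ℝ} (hx0 : 0 ≤ x) (hx1 : x ≤ 1) :
    ∫⁻ s in Ioo (0 : ℝ) 1, ENNReal.ofReal (min x s * s⁻¹) =
      ENNReal.ofReal x + ENNReal.ofReal (Real.negMulLog x) := by
  rcases hx0.eq_or_lt with rfl | hx
  · simp only [Real.negMulLog_zero, ENNReal.ofReal_zero, add_zero]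
    rw [setLIntegral_congr_fun measurableSet_Ioo (g := fun _ => 0) fun s hs => ?_]
    · simp
    · simp [min_eq_left hs.1.le]
  rw [setLIntegral_congr Ioo_ae_eq_Ioc, ← Ioc_union_Ioc_eq_Ioc hx0 hx1,
    lintegral_union measurableSet_Ioc (Ioc_disjoint_Ioc_of_le le_rfl)]
  congr 1
  · rw [setLIntegral_congr_fun measurableSet_Ioc (g := fun _ => 1) fun s hs => ?_]
    · simp
    · simp only
      rw [min_eq_right hs.2, mul_inv_cancel₀ hs.1.ne', ENNReal.ofReal_one]
  · rw [setLIntegral_congr_fun measurableSet_Ioc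
      (g := fun s => ENNReal.ofReal x * ENNReal.ofReal s⁻¹) fun s hs => ?_]
    · rw [lintegral_const_mul' _ _ ENNReal.ofReal_ne_top, ← setLIntegral_congr Ioo_ae_eq_Ioc,
        lintegral_Ioo_inv hx hx1, ← ENNReal.ofReal_mul hx0, Real.negMulLog, one_div,
        Real.log_inv, neg_mul_comm]
    · simp only
      rw [min_eq_left hs.1.le, ENNReal.ofReal_mul hx0]

theorem one_sub_excess (h0 : ∀ i, 0 ≤ ω i) (h1 : HasSum ω 1) {s : ℝ} (hs : 0 ≤ s) :
    ENNReal.ofReal (1 - excess ω s) = ∑' i, ENNReal.ofReal (min (ω i) s) := by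
  have h := h1.sub (summable_excess h0 h1.summable hs).hasSum
  have e : ∀ i, ω i - max 0 (ω i - s) = min (ω i) s := fun i => by
    rcases le_total (ω i) s with h | h
    · rw [max_eq_left (sub_nonpos.2 h), min_eq_left h, sub_zero]
    · rw [max_eq_right (sub_nonneg.2 h), min_eq_right h, sub_sub_cancel]
  simp only [e] at h
  rw [← ENNReal.ofReal_tsum_of_nonneg (fun i => le_min (h0 i) hs) h.summable, h.tsum_eq, excess]

/-- Tonelli for 1/s over the region E(s) < r of the unit square: one order of integration gives -ln
F(r), the other (1 - E(s))/s. -/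
theorem lintegral_neg_log_boundaryHeight (h0 : ∀ i, 0 ≤ ω i) (h1 : HasSum ω 1)
    (hU : ∀ r t : ℝ≥0, (r, t) ∈ U ↔ t = 0 ∨ (r : ℝ) ≤ excess ω t) :
    ∫⁻ r in Ioo 0 1, ENNReal.ofReal (-Real.log (boundaryHeight U r)) = 1 + entropy ω := by
  have hs := h1.summable
  -- Clamping the argument at 0 makes the function continuous on all of ℝ, so the region is
  -- measurable.
  let E : ℝ → ℝ := fun s => excess ω (Real.toNNReal s)
  have hE : Continuous E := (continuous_excess h0 hs).comp continuous_real_toNNReal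
  have hE' : ∀ s, 0 < s → E s = excess ω s := fun s hs => by simp [E, hs.le]
  have hmeas : MeasurableSet {p : ℝ × ℝ | E p.2 < p.1} :=
    (isOpen_lt (hE.comp continuous_snd) continuous_fst).measurableSet
  calc
    _ = ∫⁻ r in Ioo (0 : ℝ) 1, ∫⁻ s in Ioo (0 : ℝ) 1,
          {p : ℝ × ℝ | E p.2 < p.1}.indicator (fun p => ENNReal.ofReal p.2⁻¹) (r, s) := by
      refine setLIntegral_congr_fun measurableSet_Ioo fun r hr => ?_
      obtain ⟨t, ht, hrt⟩ := exists_excess_eq h0 h1 hr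
      rw [boundaryHeight_eq h0 h1 hU hr ht.1.le hrt, ← Real.log_inv, ← one_div,
        ← lintegral_Ioo_inv ht.1 ht.2.le, ← lintegral_indicator measurableSet_Ioo,
        ← lintegral_indicator measurableSet_Ioo]
      congr 1
      funext s
      by_cases hs01 : s ∈ Ioo (0 : ℝ) 1
      · have hiff : t < s ↔ E s < r := by
          rw [hE' s hs01.1, ← hrt]
          exact ⟨fun h => excess_lt_excess h0 hs ht.1.le h (hrt ▸ hr.1),
            fun h => lt_of_excess_lt h0 hs hs01.1.le h⟩
        by_cases hts : t < s
        · rw [indicator_of_mem (show s ∈ Ioo t 1 from ⟨hts, hs01.2⟩), indicator_of_mem hs01,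
            indicator_of_mem (show (r, s) ∈ {p : ℝ × ℝ | E p.2 < p.1} from hiff.1 hts)]
        · rw [indicator_of_notMem (fun h : s ∈ Ioo t 1 => hts h.1), indicator_of_mem hs01,
            indicator_of_notMem
              (fun h : (r, s) ∈ {p : ℝ × ℝ | E p.2 < p.1} => hts (hiff.2 h))]
      · rw [indicator_of_notMem (fun h : s ∈ Ioo t 1 => hs01 ⟨ht.1.trans h.1, h.2⟩),
          indicator_of_notMem hs01]
    _ = ∫⁻ s in Ioo (0 : ℝ) 1, ∫⁻ r in Ioo (0 : ℝ) 1,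
          {p : ℝ × ℝ | E p.2 < p.1}.indicator (fun p => ENNReal.ofReal p.2⁻¹) (r, s) := by
      refine lintegral_lintegral_swap (Measurable.aemeasurable ?_)
      exact (ENNReal.measurable_ofReal.comp measurable_snd.inv).indicator hmeas
    _ = ∫⁻ s in Ioo (0 : ℝ) 1, ∑' i, ENNReal.ofReal (min (ω i) s * s⁻¹) := by
      refine setLIntegral_congr_fun measurableSet_Ioo fun s hs01 => ?_
      have hind : ∀ r, {p : ℝ × ℝ | E p.2 < p.1}.indicator
          (fun p => ENNReal.ofReal p.2⁻¹) (r, s) =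
          (Ioi (E s)).indicator (fun _ => ENNReal.ofReal s⁻¹) r := fun r => rfl
      have hE0 : 0 ≤ E s := excess_nonneg ω _
      simp only [hind]
      rw [lintegral_indicator_const measurableSet_Ioi, Measure.restrict_apply measurableSet_Ioi,
        inter_comm, Ioo_inter_Ioi, max_eq_right hE0, Real.volume_Ioo, hE' s hs01.1,
        one_sub_excess h0 h1 hs01.1.le, ← ENNReal.tsum_mul_left]
      refine tsum_congr fun i => ?_
      rw [mul_comm, ENNReal.ofReal_mul (le_min (h0 i) hs01.1.le)]
    _ = ∑' i, (ENNReal.ofReal (ω i) + ENNReal.ofReal (Real.negMulLog (ω i))) := by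
      -- Exchanging sum and integral needs a countable index set, so both sums are restricted to the
      -- support.
      have : Countable (Function.support ω) := hs.countable_support.to_subtype
      have e1 : ∀ s ∈ Ioo (0 : ℝ) 1, ∑' i, ENNReal.ofReal (min (ω i) s * s⁻¹) =
          ∑' i : Function.support ω, ENNReal.ofReal (min (ω i) s * s⁻¹) := fun s hs01 =>
        (tsum_subtype_eq_of_support_subset (f := fun i => ENNReal.ofReal (min (ω i) s * s⁻¹))
          (s := Function.support ω) fun i hi (h : ω i = 0) =>
            hi (by simp [h, min_eq_left hs01.1.le])).symm
      have e2 : ∑' i, (ENNReal.ofReal (ω i) + ENNReal.ofReal (Real.negMulLog (ω i))) =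
          ∑' i : Function.support ω,
            (ENNReal.ofReal (ω i) + ENNReal.ofReal (Real.negMulLog (ω i))) :=
        (tsum_subtype_eq_of_support_subset
          (f := fun i => ENNReal.ofReal (ω i) + ENNReal.ofReal (Real.negMulLog (ω i)))
          (s := Function.support ω) fun i hi (h : ω i = 0) => hi (by simp [h])).symm
      rw [setLIntegral_congr_fun measurableSet_Ioo e1, e2,
        lintegral_tsum fun i => Measurable.aemeasurable (by fun_prop)]
      exact tsum_congr fun i => lintegral_min_div (h0 i) (le_one_of_hasSum_one h0 h1 i)
    _ = 1 + entropy ω := by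
      rw [ENNReal.tsum_add, ← ENNReal.ofReal_tsum_of_nonneg h0 hs, h1.tsum_eq,
        ENNReal.ofReal_one, entropy]

theorem boundaryLogIntegral_eq (h0 : ∀ i, 0 ≤ ω i) (h1 : HasSum ω 1)
    (hU : ∀ r t : ℝ≥0, (r, t) ∈ U ↔ t = 0 ∨ (r : ℝ) ≤ excess ω t) :
    boundaryLogIntegral U =
      -((∫⁻ r in Ioo 0 1, ENNReal.ofReal (-Real.log (boundaryHeight U r)) : ℝ≥0∞) : EReal) := by
  have : ∫⁻ r in Ioo 0 1, ENNReal.ofReal (Real.log (boundaryHeight U r)) = 0 := by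
    rw [setLIntegral_congr_fun measurableSet_Ioo (g := fun _ => 0) fun r hr =>
      ENNReal.ofReal_of_nonpos (log_boundaryHeight_nonpos h0 h1 hU hr)]
    simp
  rw [boundaryLogIntegral, extIntegral, this, EReal.coe_ennreal_zero, zero_sub]

theorem entropy_eq (h0 : ∀ i, 0 ≤ ω i) (h1 : HasSum ω 1)
    (hU : ∀ r t : ℝ≥0, (r, t) ∈ U ↔ t = 0 ∨ (r : ℝ) ≤ excess ω t) :
    ((entropy ω : ℝ≥0∞) : EReal) = -boundaryLogIntegral U - 1 := by
  rw [boundaryLogIntegral_eq h0 h1 hU, neg_neg, lintegral_neg_log_boundaryHeight h0 h1 hU,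
    EReal.coe_ennreal_add, EReal.coe_ennreal_one, add_comm]
  -- Cancelling 1 is legitimate in `EReal` even for infinite entropy, since 1 is finite.
  exact (EReal.add_sub_cancel_right (b := 1)).symm

/-- All the conclusions of the theorem for a family `ω` follow from the description of `U`. -/
theorem boundary_description (h0 : ∀ i, 0 ≤ ω i) (h1 : HasSum ω 1)
    (hU : ∀ r t : ℝ≥0, (r, t) ∈ U ↔ t = 0 ∨ (r : ℝ) ≤ excess ω t) :
    (∀ r₁ t : ℝ≥0, 0 < r₁ → r₁ < 1 → ((r₁, t) ∈ frontier U ↔ (r₁ : ℝ) = excess ω t)) ∧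
    (∀ r₁ : ℝ≥0, 0 < r₁ → r₁ < 1 → ∃! t : ℝ≥0, (r₁, t) ∈ frontier U) ∧
    ((entropy ω : ℝ≥0∞) : EReal) = -boundaryLogIntegral U - 1 ∧
    (∀ p ∈ consecutiveValues ω,
      excess ω p.1 < excess ω p.2 ∧
      (∀ r ∈ Ioo (excess ω p.1) (excess ω p.2),
        boundaryHeight U r = p.1 - (r - excess ω p.1) / countGE ω p.1) ∧
      IntervalIntegrable (fun r => Real.log (boundaryHeight U r)) volume
        (excess ω p.1) (excess ω p.2) ∧
      -(∫ r in (excess ω p.1)..(excess ω p.2), Real.log (boundaryHeight U r)) =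
        contribution ω p.1 p.2 ∧
      0 ≤ contribution ω p.1 p.2) ∧
    -boundaryLogIntegral U =
      ((∑' p : consecutiveValues ω,
        ENNReal.ofReal (contribution ω p.1.1 p.1.2) : ℝ≥0∞) : EReal) :=
  ⟨fun _ _ _ hr1 => mem_frontier_iff h0 h1 hU hr1,
    fun _ hr0 hr1 => existsUnique_mem_frontier h0 h1 hU hr0 hr1, entropy_eq h0 h1 hU,
    fun _ hp => ⟨excess_fst_lt_excess_snd h0 h1.summable hp,
      fun _ hr => boundaryHeight_eq_of_mem_Ioo h0 h1 hU hp hr,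
      intervalIntegrable_log_boundaryHeight h0 h1 hU hp,
      neg_integral_log_boundaryHeight h0 h1 hU hp, contribution_nonneg h0 h1 hU hp⟩,
    by rw [boundaryLogIntegral_eq h0 h1 hU, neg_neg,
      lintegral_neg_log_boundaryHeight_eq_tsum h0 h1 hU]⟩

end Integral

/-! ### The set U for sequences -/

section Sequences

variable {𝕜 : Type*} [RCLike 𝕜] {ι : Type*} {ω : ι → ℝ}

theorem max_zero_sub_le_norm {x v w s : ℝ} (hv : v ≤ s) (hx : x - v ≤ w) (hw : 0 ≤ w) :
    max 0 (x - s) ≤ w :=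
  max_le hw (by linarith)

theorem hasSum_norm_lp_one (f : lp (fun _ : ι => 𝕜) 1) : HasSum (fun i => ‖f i‖) ‖f‖ := by
  simpa using lp.hasSum_norm (p := 1) (by simp) f

theorem memℓp_one_ofReal {f : ι → ℝ} (hf : ∀ i, 0 ≤ f i) (hs : Summable f) :
    Memℓp (fun i => ((f i : ℝ) : 𝕜)) 1 := by
  refine memℓp_gen ?_
  simpa [abs_of_nonneg (hf _)] using hs

/-- There is `s ∈ (0, t)` with `excess ω s < r` as soon as `t > 0` and `excess ω t < r`. -/
theorem exists_pos_lt_excess_lt (h0 : ∀ i, 0 ≤ ω i) (hs : Summable ω) {r t : ℝ} (ht : 0 < t)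
    (hr : excess ω t < r) : ∃ s, 0 < s ∧ s < t ∧ excess ω s < r := by
  lift t to ℝ≥0 using ht.le
  have h1 := ((continuous_excess h0 hs).tendsto t).eventually (gt_mem_nhds hr)
  have ht' : 0 < t := by exact_mod_cast ht
  have : (nhdsWithin t (Iio t)).NeBot := nhdsLT_neBot_of_exists_lt ⟨0, ht'⟩
  obtain ⟨s, ⟨hs1, hs2⟩, hs3⟩ := ((h1.filter_mono nhdsWithin_le_nhds).and
    ((lt_mem_nhds ht' : ∀ᶠ x in nhds t, 0 < x).filter_mono nhdsWithin_le_nhds) |>.and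
    (self_mem_nhdsWithin : ∀ᶠ x in nhdsWithin t (Iio t), x < t)).exists
  exact ⟨s, by exact_mod_cast hs2, by exact_mod_cast hs3, hs1⟩

theorem mem_seqU_iff (h0 : ∀ i, 0 ≤ ω i) (hs : Summable ω) (r t : ℝ≥0) :
    (r, t) ∈ seqU 𝕜 ω ↔ t = 0 ∨ (r : ℝ) ≤ excess ω t := by
  constructor
  · intro h
    by_contra! hcon
    obtain ⟨ht, hr⟩ := hcon
    obtain ⟨s, hs0, hst, hsr⟩ := exists_pos_lt_excess_lt h0 hs
      (by exact_mod_cast pos_iff_ne_zero.2 ht) hr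
    -- The witnesses are a = ω, b = 0, x = min(ω, s): then ‖x - a‖_1 = E(s) < r and ‖x‖_∞ ≤ s.
    -- Taking s < t makes the second inequality strict.
    let a : lp (fun _ : ι => 𝕜) 1 := ⟨_, memℓp_one_ofReal h0 hs⟩
    have hmin : Summable fun i => min (ω i) s :=
      hs.of_nonneg_of_le (fun i => le_min (h0 i) hs0.le) fun i => min_le_left _ _
    let x : lp (fun _ : ι => 𝕜) 1 :=
      ⟨_, memℓp_one_ofReal (fun i => le_min (h0 i) hs0.le) hmin⟩
    have hax : ∀ i, ‖(x - a) i‖ = max 0 (ω i - s) := fun i => by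
      change ‖((min (ω i) s : ℝ) : 𝕜) - ((ω i : ℝ) : 𝕜)‖ = _
      rw [← RCLike.ofReal_sub, RCLike.norm_ofReal]
      rcases le_total (ω i) s with h | h
      · rw [min_eq_left h, max_eq_left (sub_nonpos.2 h), sub_self, abs_zero]
      · rw [min_eq_right h, max_eq_right (sub_nonneg.2 h), abs_sub_comm,
          abs_of_nonneg (sub_nonneg.2 h)]
    refine Set.disjoint_left.1 (h a 0 fun i => by simp [a]) (mem_image_of_mem _ (?_ : x ∈ _)) ?_
    · rw [mem_ball_iff_norm, ← (hasSum_norm_lp_one (x - a)).tsum_eq, tsum_congr hax]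
      exact hsr
    · rw [mem_ball_iff_norm, map_zero, sub_zero]
      refine (lp.norm_le_of_forall_le hs0.le fun i => ?_).trans_lt hst
      rw [lp.coe_linearMapOfLE_apply]
      change ‖((min (ω i) s : ℝ) : 𝕜)‖ ≤ s
      rw [RCLike.norm_ofReal, abs_of_nonneg (le_min (h0 i) hs0.le)]
      exact min_le_right _ _
  · rintro h a b hab
    refine Set.disjoint_left.2 ?_
    rintro _ ⟨x, hxa, rfl⟩ hxb
    rw [mem_ball_iff_norm] at hxa hxb
    rw [← map_sub] at hxb
    rcases h with h | h
    -- A ball of radius 0 is empty.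
    · rw [h] at hxb
      exact absurd (norm_nonneg _) (not_le.2 hxb)
    · refine absurd hxa (not_lt.2 (h.trans ?_))
      have hsum := hasSum_norm_lp_one (x - a)
      rw [← hsum.tsum_eq]
      refine (summable_excess h0 hs t.2).tsum_le_tsum (fun i => ?_) hsum.summable
      have h1 : ‖(x - b) i‖ ≤ t := by
        refine le_trans ?_ hxb.le
        simpa using lp.norm_apply_le_norm (p := ∞) (by simp) (lp.linearMapOfLE 𝕜 (fun _ : ι => 𝕜)
          (le_top : (1 : ℝ≥0∞) ≤ ∞) (x - b)) i
      refine max_zero_sub_le_norm h1 ?_ (norm_nonneg _)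
      have h2 : ((ω i : ℝ) : 𝕜) = (x - b) i - (x - a) i := by
        rw [← hab i]
        simp
      calc ω i - ‖(x - b) i‖ = ‖((ω i : ℝ) : 𝕜)‖ - ‖(x - b) i‖ := by
            rw [RCLike.norm_ofReal, abs_of_nonneg (h0 i)]
        _ ≤ ‖(x - a) i‖ := by
            rw [h2]
            linarith [norm_sub_le ((x - b) i) ((x - a) i)]

end Sequences

section Hilbert

variable {H : Type*} [NormedAddCommGroup H] [InnerProductSpace ℂ H]

/-! ### Operators with a square-summable family of images are compact -/

/-- Cauchy–Schwarz and Bessel: the operator norm is at most the Hilbert–Schmidt norm. -/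
theorem norm_sum_inner_smul_le {κ : Type*} {e : κ → H} (he : Orthonormal ℂ e) (v : κ → H)
    (s : Finset κ) (x : H) :
    ‖∑ i ∈ s, ⟪e i, x⟫_ℂ • v i‖ ≤ √(∑ i ∈ s, ‖v i‖ ^ 2) * ‖x‖ :=
  calc
    _ ≤ ∑ i ∈ s, ‖v i‖ * ‖⟪e i, x⟫_ℂ‖ :=
      norm_sum_le_of_le _ fun i _ => by rw [norm_smul, mul_comm]
    _ ≤ √(∑ i ∈ s, ‖v i‖ ^ 2) * √(∑ i ∈ s, ‖⟪e i, x⟫_ℂ‖ ^ 2) :=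
      Real.sum_mul_le_sqrt_mul_sqrt _ _ _
    _ ≤ √(∑ i ∈ s, ‖v i‖ ^ 2) * ‖x‖ := by
      gcongr
      exact Real.sqrt_le_left (norm_nonneg _) |>.2 (he.sum_inner_products_le x)

theorem isCompactOperator_rankOne (x y : H) :
    IsCompactOperator (InnerProductSpace.rankOne ℂ x y) := by
  have h : IsCompactOperator (ContinuousLinearMap.toSpanSingleton ℂ x) :=
    isCompactOperator_of_locallyCompactSpace_rng (ContinuousLinearMap.toSpanSingleton ℂ x)
  exact h.comp_clm (innerSL ℂ y)

theorem eigenvalues_nonneg {T : H →L[ℂ] H} (hT : T.IsPositive) {e : EigenIndex T → H}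
    (he : Orthonormal ℂ e) (heT : ∀ k, T (e k) = (eigenvalues T k : ℂ) • e k) (k : EigenIndex T) :
    0 ≤ eigenvalues T k := by
  have := hT.2 (e k)
  rw [ContinuousLinearMap.reApplyInnerSelf_apply, heT, inner_smul_left, Complex.conj_ofReal,
    inner_self_eq_norm_sq_to_K, he.1 k] at this
  simpa using this

theorem inner_mul_inner_symm (x y : H) : ⟪x, y⟫_ℂ * ⟪y, x⟫_ℂ = ((‖⟪x, y⟫_ℂ‖ ^ 2 : ℝ) : ℂ) := by
  rw [← inner_conj_symm y x, Complex.mul_conj, Complex.normSq_eq_norm_sq]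

/-- `P = ∑ σ_k ⟨e_k, ·⟩ e_k`. -/
def IsDiagonal {κ : Type*} (e : κ → H) (σ : κ → ℝ) (P : H →L[ℂ] H) : Prop :=
  ∀ x, HasSum (fun k => ((σ k : ℂ) * ⟪e k, x⟫_ℂ) • e k) (P x)

section

variable {κ : Type*} {e : κ → H} {σ τ : κ → ℝ} {P Q : H →L[ℂ] H}

theorem IsDiagonal.sub (hP : IsDiagonal e σ P) (hQ : IsDiagonal e τ Q) :
    IsDiagonal e (fun k => σ k - τ k) (P - Q) := fun x => by
  have := (hP x).sub (hQ x)
  simp only [← sub_smul, ← sub_mul, ← Complex.ofReal_sub] at this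
  exact this

theorem IsDiagonal.hasSum_inner (hP : IsDiagonal e σ P) (x y : H) :
    HasSum (fun k => (σ k : ℂ) * ⟪e k, y⟫_ℂ * ⟪x, e k⟫_ℂ) ⟪x, P y⟫_ℂ := by
  have := (hP y).mapL (innerSL ℂ x)
  simpa only [innerSL_apply_apply, inner_smul_right] using this

theorem IsDiagonal.hasSum_re_inner (hP : IsDiagonal e σ P) (x : H) :
    HasSum (fun k => σ k * ‖⟪e k, x⟫_ℂ‖ ^ 2) (RCLike.re ⟪x, P x⟫_ℂ) := by
  have := (hP.hasSum_inner x x).mapL Complex.reCLM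
  simp only [mul_assoc, inner_mul_inner_symm, Complex.reCLM_apply, Complex.re_ofReal_mul,
    Complex.ofReal_re] at this
  exact this

theorem IsDiagonal.isSymmetric (hP : IsDiagonal e σ P) : (P : H →ₗ[ℂ] H).IsSymmetric := fun x y => by
  have h1 := hP.hasSum_inner x y
  have h2 := (hP.hasSum_inner y x).star
  rw [← starRingEnd_apply, inner_conj_symm] at h2
  simp only [star_mul', RCLike.star_def, inner_conj_symm, Complex.conj_ofReal] at h2
  simp only [mul_assoc, mul_comm ⟪e _, y⟫_ℂ] at h1
  simp only [mul_assoc] at h2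
  exact h2.unique h1

theorem IsDiagonal.isPositive (hP : IsDiagonal e σ P) (hσ : ∀ k, 0 ≤ σ k) : P.IsPositive := by
  refine ⟨hP.isSymmetric, fun x => ?_⟩
  rw [ContinuousLinearMap.reApplyInnerSelf_apply, inner_re_symm]
  exact (hP.hasSum_re_inner x).nonneg fun k => mul_nonneg (hσ k) (by positivity)

/-- Exchange the nonnegative double sum and apply Parseval to each e_k. The sums may be infinite,
and e need not be complete. -/
theorem IsDiagonal.tsum_re_inner (hP : IsDiagonal e σ P) (he : Orthonormal ℂ e) (hσ : ∀ k, 0 ≤ σ k)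
    {ι : Type*} (b : HilbertBasis ι ℂ H) :
    ∑' i, ENNReal.ofReal (RCLike.re ⟪b i, P (b i)⟫_ℂ) = ∑' k, ENNReal.ofReal (σ k) := by
  have h1 : ∀ i, ENNReal.ofReal (RCLike.re ⟪b i, P (b i)⟫_ℂ) =
      ∑' k, ENNReal.ofReal (σ k * ‖⟪e k, b i⟫_ℂ‖ ^ 2) := fun i => by
    have := hP.hasSum_re_inner (b i)
    rw [← ENNReal.ofReal_tsum_of_nonneg (fun k => mul_nonneg (hσ k) (by positivity))
      this.summable, this.tsum_eq]
  simp only [h1]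
  rw [ENNReal.tsum_comm]
  refine tsum_congr fun k => ?_
  have h2 : HasSum (fun i => ‖⟪e k, b i⟫_ℂ‖ ^ 2) 1 := by
    have := (b.hasSum_inner_mul_inner (e k) (e k)).mapL Complex.reCLM
    simpa only [inner_mul_inner_symm, inner_self_eq_norm_sq_to_K, he.1 k, Complex.reCLM_apply,
      Complex.ofReal_re, Complex.coe_algebraMap, Complex.ofReal_one, one_pow, Complex.one_re]
      using this
  have h3 := h2.mul_left (σ k)
  rw [← ENNReal.ofReal_tsum_of_nonneg (fun i => mul_nonneg (hσ k) (by positivity)) h3.summable,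
    h3.tsum_eq, mul_one]

end

variable [CompleteSpace H]

/-- The finite-rank partial sums of ∑ ⟨b_i, ·⟩ A b_i are Cauchy in operator norm, by the
Hilbert–Schmidt bound on tails. -/
theorem isCompactOperator_of_summable_norm_sq {ι : Type*} (b : HilbertBasis ι ℂ H) (A : H →L[ℂ] H)
    (hA : Summable fun i => ‖A (b i)‖ ^ 2) : IsCompactOperator A := by
  have hs : Summable fun i => InnerProductSpace.rankOne ℂ (A (b i)) (b i) := by
    rw [summable_iff_vanishing_norm]
    intro ε hε
    obtain ⟨s, hs⟩ := summable_iff_vanishing_norm.1 hA ((ε / 2) ^ 2) (by positivity)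
    refine ⟨s, fun t ht => lt_of_le_of_lt ?_ (half_lt_self hε)⟩
    have h1 := hs t ht
    rw [Real.norm_of_nonneg (by positivity)] at h1
    refine ContinuousLinearMap.opNorm_le_bound _ (by positivity) fun x => ?_
    rw [sum_apply]
    simp only [InnerProductSpace.rankOne_apply]
    refine (norm_sum_inner_smul_le b.orthonormal _ t x).trans ?_
    gcongr
    exact Real.sqrt_le_left (by positivity) |>.2 h1.le
  obtain ⟨B, hB⟩ := hs
  have hAB : A = B := by
    ext x
    have h1 := (b.hasSum_repr x).mapL A
    have h2 := hB.mapL (ContinuousLinearMap.apply ℂ H x)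
    refine h1.unique ?_
    simpa [b.repr_apply_apply] using h2
  rw [hAB]
  refine isCompactOperator_of_tendsto hB (Filter.Eventually.of_forall fun s => ?_)
  exact (compactOperator (RingHom.id ℂ) H H).sum_mem fun i _ => isCompactOperator_rankOne _ _

/-- Since ‖√P b_i‖² = ⟨b_i, P b_i⟩, finite trace makes √P Hilbert–Schmidt, hence compact, and P = √P
√P. -/
theorem isCompactOperator_of_isPositive {ι : Type*} (b : HilbertBasis ι ℂ H) {P : H →L[ℂ] H}
    (hP : P.IsPositive)
    (hfin : ∑' i, ENNReal.ofReal (RCLike.re ⟪b i, P (b i)⟫_ℂ) ≠ ∞) : IsCompactOperator P := by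
  have hP0 : 0 ≤ P := (ContinuousLinearMap.nonneg_iff_isPositive P).2 hP
  have hS : (CFC.sqrt P).IsPositive :=
    (ContinuousLinearMap.nonneg_iff_isPositive _).1 (CFC.sqrt_nonneg P)
  have hSS : CFC.sqrt P * CFC.sqrt P = P := CFC.sqrt_mul_sqrt_self P hP0
  have hnorm : ∀ x, ‖CFC.sqrt P x‖ ^ 2 = RCLike.re ⟪x, P x⟫_ℂ := fun x => by
    rw [← inner_self_eq_norm_sq (𝕜 := ℂ)]
    conv_rhs => rw [← hSS]
    exact congrArg RCLike.re (hS.isSymmetric x (CFC.sqrt P x))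
  have hcomp : IsCompactOperator (CFC.sqrt P : H →L[ℂ] H) := by
    refine isCompactOperator_of_summable_norm_sq b _ ?_
    have := ENNReal.summable_toReal hfin
    simp only [← hnorm] at this
    simpa [ENNReal.toReal_ofReal] using this
  have h2 := hcomp.clm_comp (CFC.sqrt P)
  rw [← hSS]
  exact h2

/-! ### Diagonal operators -/

/-- An operator vanishing on the orthogonal complement of an orthonormal family is determined by
its values on that family. -/
theorem hasSum_inner_smul_apply {κ : Type*} {e : κ → H} (he : Orthonormal ℂ e) {A : H →L[ℂ] H}
    (hA : ∀ x, (∀ k, ⟪e k, x⟫_ℂ = 0) → A x = 0) (x : H) :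
    HasSum (fun k => ⟪e k, x⟫_ℂ • A (e k)) (A x) := by
  -- In a Hilbert basis extending e, the additional vectors are orthogonal to e, so A kills them.
  obtain ⟨w, b, hw, hb⟩ := he.toSubtypeRange.exists_hilbertBasis_extension
  have hbv : ∀ v, b v = (v : H) := fun v => congrFun hb v
  let g : κ → w := fun k => ⟨e k, hw (mem_range_self k)⟩
  have hg : Function.Injective g := fun k l h =>
    he.linearIndependent.injective (congrArg Subtype.val h)
  have h1 := (b.hasSum_repr x).mapL A
  rw [← hg.hasSum_iff] at h1
  · convert h1 using 2 with k
    simp [b.repr_apply_apply, hbv, g]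
  · intro v hv
    rw [map_smul, hA, smul_zero]
    intro k
    have : (g k) ≠ v := fun h => hv ⟨k, h⟩
    simpa [hbv, g] using b.orthonormal.2 this

namespace IsDiagonal

variable {κ : Type*} {e : κ → H} {σ : κ → ℝ} {P : H →L[ℂ] H}

/-- Bessel gives 0 ≤ P ≤ s in the operator order, which bounds the norm in a C⋆-algebra. -/
theorem norm_le (hP : IsDiagonal e σ P) (he : Orthonormal ℂ e) (hσ : ∀ k, 0 ≤ σ k) {s : ℝ}
    (hs : 0 ≤ s) (hσs : ∀ k, σ k ≤ s) : ‖P‖ ≤ s := by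
  rw [CStarAlgebra.norm_le_iff_le_algebraMap P hs
    ((ContinuousLinearMap.nonneg_iff_isPositive P).2 (hP.isPositive hσ)),
    ContinuousLinearMap.le_def]
  have halg : ∀ x, algebraMap ℝ (H →L[ℂ] H) s x = (s : ℂ) • x := fun x => rfl
  refine ⟨fun x y => ?_, fun x => ?_⟩
  · have := hP.isSymmetric x y
    change ⟪algebraMap ℝ (H →L[ℂ] H) s x - P x, y⟫_ℂ = ⟪x, algebraMap ℝ (H →L[ℂ] H) s y - P y⟫_ℂ
    change ⟪P x, y⟫_ℂ = ⟪x, P y⟫_ℂ at this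
    rw [halg, halg, inner_sub_left, inner_sub_right, inner_smul_left, inner_smul_right, this,
      Complex.conj_ofReal]
  · have h1 : RCLike.re ⟪x, P x⟫_ℂ ≤ s * ‖x‖ ^ 2 := by
      refine le_trans ?_ (mul_le_mul_of_nonneg_left (he.tsum_inner_products_le x) hs)
      rw [← tsum_mul_left]
      exact hasSum_le (fun k => mul_le_mul_of_nonneg_right (hσs k) (by positivity))
        (hP.hasSum_re_inner x) ((he.inner_products_summable x).mul_left s).hasSum
    rw [ContinuousLinearMap.reApplyInnerSelf_apply, inner_re_symm, sub_apply,
      halg, inner_sub_right, inner_smul_right, map_sub, RCLike.re_to_complex, Complex.re_ofReal_mul,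
      ← RCLike.re_to_complex, inner_self_eq_norm_sq]
    linarith

theorem traceNorm_eq (hP : IsDiagonal e σ P) (he : Orthonormal ℂ e) (hσ : ∀ k, 0 ≤ σ k) :
    traceNorm P = ∑' k, ENNReal.ofReal (σ k) := by
  rw [traceNorm, CFC.abs_of_nonneg P
    ((ContinuousLinearMap.nonneg_iff_isPositive P).2 (hP.isPositive hσ))]
  exact hP.tsum_re_inner he hσ (basis H)

end IsDiagonal

/-! ### The spectral theorem for compact symmetric operators -/

/-- Concatenate orthonormal bases of the finite-dimensional, mutually orthogonal eigenspaces for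
nonzero real eigenvalues. If x is orthogonal to all of them, its component orthogonal to the kernel
is orthogonal to every eigenspace, hence zero by the spectral theorem. -/
theorem exists_orthonormal_eigenvectors {T : H →L[ℂ] H} (hT : IsCompactOperator T)
    (hS : (T : H →ₗ[ℂ] H).IsSymmetric) :
    ∃ e : EigenIndex T → H, Orthonormal ℂ e ∧
      (∀ k, T (e k) = (eigenvalues T k : ℂ) • e k) ∧
      ∀ x, (∀ k, ⟪e k, x⟫_ℂ = 0) → T x = 0 := by
  have hfd : ∀ μ : {μ : ℝ // μ ≠ 0}, FiniteDimensional ℂ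
      (Module.End.eigenspace (T : H →ₗ[ℂ] H) ((μ : ℝ) : ℂ)) := fun μ =>
    T.finite_dimensional_eigenspace hT _ (Complex.ofReal_ne_zero.2 μ.2)
  let V := fun μ : {μ : ℝ // μ ≠ 0} => Module.End.eigenspace (T : H →ₗ[ℂ] H) ((μ : ℝ) : ℂ)
  let B := fun μ : {μ : ℝ // μ ≠ 0} => stdOrthonormalBasis ℂ (V μ)
  have hV : OrthogonalFamily ℂ (fun μ => V μ) fun μ => (V μ).subtypeₗᵢ :=
    hS.orthogonalFamily_eigenspaces.comp
      (Complex.ofReal_injective.comp Subtype.val_injective)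
  refine ⟨fun k => (B k.1 k.2 : H),
    hV.orthonormal_sigma_orthonormal (v_family := fun μ => B μ) fun μ => (B μ).orthonormal,
    fun k => Module.End.mem_eigenspace_iff.1 (B k.1 k.2).2, fun x hx => ?_⟩
  have hxμ : ∀ μ : ℂ, μ ≠ 0 → ∀ y ∈ Module.End.eigenspace (T : H →ₗ[ℂ] H) μ, ⟪y, x⟫_ℂ = 0 := by
    intro μ hμ y hy
    by_cases hy0 : y = 0
    · simp [hy0]
    -- The spectral theorem ranges over complex μ, but a symmetric operator has only real
    -- eigenvalues.
    have hreal : ((μ.re : ℝ) : ℂ) = μ := Complex.conj_eq_iff_re.1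
      (hS.conj_eigenvalue_eq_self (Module.End.hasEigenvalue_of_hasEigenvector ⟨hy, hy0⟩))
    have hre : μ.re ≠ 0 := fun h => hμ (by rw [← hreal, h, Complex.ofReal_zero])
    let ν : {μ : ℝ // μ ≠ 0} := ⟨μ.re, hre⟩
    have hy' : y ∈ V ν := by
      simpa only [V, ν, hreal] using hy
    have h1 := (B ν).sum_repr ⟨y, hy'⟩
    have h2 : y = ∑ i, (B ν).repr ⟨y, hy'⟩ i • (B ν i : H) := by
      have := congrArg Subtype.val h1
      simpa using this.symm
    rw [h2, sum_inner]
    refine Finset.sum_eq_zero fun i _ => ?_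
    rw [inner_smul_left, hx ⟨ν, i⟩, mul_zero]
  let K := Module.End.eigenspace (T : H →ₗ[ℂ] H) 0
  have hK : IsClosed (K : Set H) := by
    have : (K : Set H) = T ⁻¹' {0} := by
      ext y
      simp [K]
    rw [this]
    exact isClosed_singleton.preimage T.continuous
  have : CompleteSpace K := hK.completeSpace_coe
  obtain ⟨y, hy, z, hz, rfl⟩ := K.exists_add_mem_mem_orthogonal x
  have hz0 : z ∈ (⨆ μ, Module.End.eigenspace (T : H →ₗ[ℂ] H) μ)ᗮ := by
    rw [← Submodule.iInf_orthogonal, Submodule.mem_iInf]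
    intro μ u hu
    rcases eq_or_ne μ 0 with rfl | hμ
    · exact hz u hu
    · have h1 := hxμ μ hμ u hu
      rw [inner_add_right] at h1
      have h2 : ⟪u, y⟫_ℂ = 0 :=
        hS.orthogonalFamily_eigenspaces.isOrtho hμ |>.inner_eq hu hy
      rwa [h2, zero_add] at h1
  rw [T.orthogonalComplement_iSup_eigenspaces_eq_bot hT hS, Submodule.mem_bot] at hz0
  rw [hz0, add_zero]
  simpa [K, Module.End.mem_eigenspace_iff] using hy

theorem isDiagonal_of_eigenvectors {κ : Type*} {T : H →L[ℂ] H} {e : κ → H} {σ : κ → ℝ}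
    (he : Orthonormal ℂ e) (heT : ∀ k, T (e k) = (σ k : ℂ) • e k)
    (h0 : ∀ x, (∀ k, ⟪e k, x⟫_ℂ = 0) → T x = 0) : IsDiagonal e σ T := fun x => by
  convert hasSum_inner_smul_apply he h0 x using 2 with k
  rw [heT, smul_smul, mul_comm]

end Hilbert

/-! ### Trace norm estimates and the set U for operators -/

section Operators

variable {H : Type*} [NormedAddCommGroup H] [InnerProductSpace ℂ H]

theorem sum_norm_inner_mul_norm_inner_le {κ : Type*} {e : κ → H} (he : Orthonormal ℂ e)
    (s : Finset κ) (x y : H) :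
    ∑ k ∈ s, ‖⟪e k, x⟫_ℂ‖ * ‖⟪e k, y⟫_ℂ‖ ≤ ‖x‖ * ‖y‖ := by
  refine (Real.sum_mul_le_sqrt_mul_sqrt _ _ _).trans ?_
  gcongr
  · exact Real.sqrt_le_left (norm_nonneg _) |>.2 (he.sum_inner_products_le x)
  · exact Real.sqrt_le_left (norm_nonneg _) |>.2 (he.sum_inner_products_le y)

theorem tsum_enorm_inner_mul_enorm_inner_le {κ : Type*} {e : κ → H} (he : Orthonormal ℂ e)
    (x y : H) : ∑' k, ‖⟪e k, x⟫_ℂ‖ₑ * ‖⟪e k, y⟫_ℂ‖ₑ ≤ ‖x‖ₑ * ‖y‖ₑ := by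
  rw [ENNReal.tsum_eq_iSup_sum]
  refine iSup_le fun s => ?_
  simp only [← ofReal_norm, ← ENNReal.ofReal_mul (norm_nonneg _)]
  rw [← ENNReal.ofReal_sum_of_nonneg fun k _ => by positivity]
  exact ENNReal.ofReal_le_ofReal (sum_norm_inner_mul_norm_inner_le he s x y)

/-- For `s > 0` the operator `(T - s)⁺` has finite rank. -/
theorem exists_isDiagonal_posPart {κ : Type*} {σ : κ → ℝ} (hs : Summable σ) (e : κ → H) {s : ℝ}
    (hs0 : 0 < s) : ∃ W : H →L[ℂ] H, IsDiagonal e (fun k => max 0 (σ k - s)) W := by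
  refine ⟨∑ k ∈ (finite_setOf_le hs hs0).toFinset,
    ((max 0 (σ k - s) : ℝ) : ℂ) • InnerProductSpace.rankOne ℂ (e k) (e k), fun x => ?_⟩
  rw [sum_apply]
  simp only [smul_apply, InnerProductSpace.rankOne_apply, smul_smul]
  refine hasSum_sum_of_ne_finset_zero fun k hk => ?_
  have hk : σ k < s := by simpa using hk
  rw [max_eq_left (by linarith), Complex.ofReal_zero, zero_mul, zero_smul]

variable [CompleteSpace H]

theorem norm_abs_apply (W : H →L[ℂ] H) (x : H) : ‖CFC.abs W x‖ = ‖W x‖ := by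
  have hpos : (CFC.abs W).IsPositive :=
    (ContinuousLinearMap.nonneg_iff_isPositive _).1 (CFC.abs_nonneg W)
  have h1 : ⟪CFC.abs W x, CFC.abs W x⟫_ℂ = ⟪W x, W x⟫_ℂ :=
    calc
      _ = ⟪x, (CFC.abs W * CFC.abs W) x⟫_ℂ := hpos.isSymmetric x (CFC.abs W x)
      _ = ⟪x, (star W * W) x⟫_ℂ := by rw [CFC.abs_mul_abs]
      _ = ⟪W x, W x⟫_ℂ := ContinuousLinearMap.adjoint_inner_right W x (W x)
  rw [inner_self_eq_norm_sq_to_K, inner_self_eq_norm_sq_to_K] at h1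
  exact (sq_eq_sq₀ (norm_nonneg _) (norm_nonneg _)).1 (by exact_mod_cast h1)

/-- The diagonal of an operator in an orthonormal family is bounded by its trace norm. -/
theorem tsum_enorm_inner_apply_le_traceNorm {κ : Type*} {e : κ → H} (he : Orthonormal ℂ e)
    (W : H →L[ℂ] H) : ∑' k, ‖⟪e k, W (e k)⟫_ℂ‖ₑ ≤ traceNorm W := by
  by_cases hW : traceNorm W = ∞
  · rw [hW]
    exact le_top
  have hpos : (CFC.abs W).IsPositive :=
    (ContinuousLinearMap.nonneg_iff_isPositive _).1 (CFC.abs_nonneg W)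
  -- Finite trace makes |W| compact. Its eigenvectors g_j satisfy ‖W g_j‖ = σ_j, and |W| and W have
  -- the same kernel, so W x = ∑ ⟨g_j, x⟩ W g_j.
  obtain ⟨g, hg, hgW, hg0⟩ := exists_orthonormal_eigenvectors
    (isCompactOperator_of_isPositive (basis H) hpos hW) hpos.isSymmetric
  have hσ := eigenvalues_nonneg hpos hg hgW
  have htr : traceNorm W = ∑' j, ENNReal.ofReal (eigenvalues (CFC.abs W) j) :=
    (isDiagonal_of_eigenvectors hg hgW hg0).tsum_re_inner hg hσ (basis H)
  have hWg : ∀ j, ‖W (g j)‖ₑ = ENNReal.ofReal (eigenvalues (CFC.abs W) j) := fun j => by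
    rw [← ofReal_norm, ← norm_abs_apply, hgW, norm_smul, hg.1 j, mul_one,
      Complex.norm_real, Real.norm_of_nonneg (hσ j)]
  have hexp : ∀ x, HasSum (fun j => ⟪g j, x⟫_ℂ • W (g j)) (W x) :=
    hasSum_inner_smul_apply hg fun x hx => by
      rw [← norm_eq_zero, ← norm_abs_apply, hg0 x hx, norm_zero]
  calc
    ∑' k, ‖⟪e k, W (e k)⟫_ℂ‖ₑ ≤ ∑' k, ∑' j, ‖⟪e k, g j⟫_ℂ‖ₑ * ‖⟪e k, W (g j)⟫_ℂ‖ₑ := by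
      refine ENNReal.tsum_le_tsum fun k => ?_
      have h1 := (hexp (e k)).mapL (innerSL ℂ (e k))
      simp only [innerSL_apply_apply, inner_smul_right] at h1
      rw [← h1.tsum_eq]
      refine enorm_tsum_le_tsum_enorm.trans_eq (tsum_congr fun j => ?_)
      rw [enorm_mul, ← ofReal_norm ⟪g j, e k⟫_ℂ, norm_inner_symm, ofReal_norm]
    _ = ∑' j, ∑' k, ‖⟪e k, g j⟫_ℂ‖ₑ * ‖⟪e k, W (g j)⟫_ℂ‖ₑ := ENNReal.tsum_comm
    _ ≤ ∑' j, ‖g j‖ₑ * ‖W (g j)‖ₑ :=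
      ENNReal.tsum_le_tsum fun j => tsum_enorm_inner_mul_enorm_inner_le he _ _
    _ = traceNorm W := by
      rw [htr]
      refine tsum_congr fun j => ?_
      rw [hWg, ← ofReal_norm, hg.1 j, ENNReal.ofReal_one, one_mul]

theorem exists_isDiagonal_of_mem_densityOperators {T : H →L[ℂ] H} (hT : T ∈ densityOperators H) :
    ∃ e : EigenIndex T → H, Orthonormal ℂ e ∧ (∀ k, T (e k) = (eigenvalues T k : ℂ) • e k) ∧
      IsDiagonal e (eigenvalues T) T ∧ (∀ k, 0 ≤ eigenvalues T k) ∧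
      HasSum (eigenvalues T) 1 := by
  obtain ⟨htc, hpos, htr⟩ := hT
  have habs : CFC.abs T = T :=
    CFC.abs_of_nonneg T ((ContinuousLinearMap.nonneg_iff_isPositive T).2 hpos)
  have hfin : ∑' i, ENNReal.ofReal (RCLike.re ⟪basis H i, T (basis H i)⟫_ℂ) ≠ ∞ := by
    have := htc.ne
    rwa [traceNorm, habs] at this
  obtain ⟨e, he, heT, he0⟩ := exists_orthonormal_eigenvectors
    (isCompactOperator_of_isPositive (basis H) hpos hfin) hpos.isSymmetric
  have hd := isDiagonal_of_eigenvectors he heT he0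
  have hσ := eigenvalues_nonneg hpos he heT
  refine ⟨e, he, heT, hd, hσ, ?_⟩
  have hsum := hd.tsum_re_inner he hσ (basis H)
  have hs : Summable (eigenvalues T) := by
    have := ENNReal.summable_toReal (hsum ▸ hfin)
    simpa only [ENNReal.toReal_ofReal (hσ _)] using this
  have hre : ∀ x, 0 ≤ RCLike.re ⟪x, T x⟫_ℂ := hpos.re_inner_nonneg_right
  -- Diagonal entries of a positive operator are real, so the condition on the complex trace becomes
  -- a real sum, comparable with the sum of eigenvalues.
  have h1 : trace T =
      ((∑' i, RCLike.re ⟪basis H i, T (basis H i)⟫_ℂ : ℝ) : ℂ) := by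
    rw [trace, Complex.ofReal_tsum]
    exact tsum_congr fun i => (hpos.isSymmetric.coe_re_inner_self_apply (basis H i)).symm
  have h2 : ∑' i, RCLike.re ⟪basis H i, T (basis H i)⟫_ℂ = ∑' k, eigenvalues T k := by
    have := congrArg ENNReal.toReal hsum
    rw [ENNReal.tsum_toReal_eq fun _ => ENNReal.ofReal_ne_top,
      ENNReal.tsum_toReal_eq fun _ => ENNReal.ofReal_ne_top] at this
    simpa only [ENNReal.toReal_ofReal (hσ _), ENNReal.toReal_ofReal (hre _)] using this
  have h3 : ∑' k, eigenvalues T k = 1 := by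
    rw [h1, h2] at htr
    exact_mod_cast htr
  exact h3 ▸ hs.hasSum

theorem mem_opU_iff {T : H →L[ℂ] H} (hT : T ∈ densityOperators H) (r t : ℝ≥0) :
    (r, t) ∈ opU T ↔ t = 0 ∨ (r : ℝ) ≤ excess (eigenvalues T) t := by
  obtain ⟨e, he, heT, hd, h0, h1⟩ := exists_isDiagonal_of_mem_densityOperators hT
  have hs := h1.summable
  have hexcess : ∀ s : ℝ, 0 ≤ s → ∑' k, ENNReal.ofReal (max 0 (eigenvalues T k - s)) =
      ENNReal.ofReal (excess (eigenvalues T) s) := fun s hs0 =>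
    (ENNReal.ofReal_tsum_of_nonneg (fun k => le_max_left _ _) (summable_excess h0 hs hs0)).symm
  constructor
  · intro h
    by_contra! hcon
    obtain ⟨ht, hr⟩ := hcon
    obtain ⟨s, hs0, hst, hsr⟩ := exists_pos_lt_excess_lt h0 hs
      (by exact_mod_cast pos_iff_ne_zero.2 ht) hr
    obtain ⟨W, hW⟩ := exists_isDiagonal_posPart hs e hs0
    -- With W = (T - s)⁺, the operator T - W has eigenvalues min(ω_k, s) on e. It plays the role of
    -- the truncated sequence, with A = T and B = 0.
    have hX := hd.sub hW
    have hmin : ∀ k, 0 ≤ eigenvalues T k - max 0 (eigenvalues T k - s) := fun k =>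
      sub_nonneg.2 (max_le (h0 k) (by linarith))
    refine Set.disjoint_left.1 (h T 0 hT.1 (by simp [IsTraceClass, traceNorm]) (sub_zero T))
      (show T - W ∈ traceBall T r from ⟨?_, ?_⟩) ?_
    · rw [IsTraceClass, hX.traceNorm_eq he hmin]
      refine lt_of_le_of_lt (ENNReal.tsum_le_tsum fun k =>
        ENNReal.ofReal_le_ofReal (sub_le_self _ (le_max_left _ _))) ?_
      rw [← ENNReal.ofReal_tsum_of_nonneg h0 hs]
      exact ENNReal.ofReal_lt_top
    · rw [sub_sub_cancel_left, traceNorm, CFC.abs_neg, ← traceNorm,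
        hW.traceNorm_eq he fun k => le_max_left _ _, hexcess s hs0.le,
        ENNReal.ofReal_lt_coe_iff (excess_nonneg _ _)]
      exact hsr
    · rw [mem_ball_zero_iff]
      refine (hX.norm_le he hmin hs0.le fun k => ?_).trans_lt hst
      linarith [le_max_right 0 (eigenvalues T k - s)]
  · rintro h A B - - hAB
    refine Set.disjoint_left.2 fun X hXA hXB => ?_
    rw [mem_ball_iff_norm] at hXB
    rcases h with h | h
    · rw [h] at hXB
      exact absurd (norm_nonneg _) (not_le.2 hXB)
    · refine absurd hXA.2 (not_lt.2 ?_)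
      calc (r : ℝ≥0∞) = ENNReal.ofReal r := (ENNReal.ofReal_coe_nnreal).symm
        _ ≤ ENNReal.ofReal (excess (eigenvalues T) t) := ENNReal.ofReal_le_ofReal h
        _ = ∑' k, ENNReal.ofReal (max 0 (eigenvalues T k - t)) := (hexcess t t.2).symm
        -- Comparing diagonal entries in the eigenbasis of T reduces this to the scalar inequality
        -- for sequences; X, A and B need not commute with T.
        _ ≤ ∑' k, ‖⟪e k, (X - A) (e k)⟫_ℂ‖ₑ := by
          refine ENNReal.tsum_le_tsum fun k => ?_
          rw [← ofReal_norm]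
          refine ENNReal.ofReal_le_ofReal ?_
          have h2 : ‖⟪e k, (X - B) (e k)⟫_ℂ‖ ≤ t := by
            refine (norm_inner_le_norm _ _).trans ?_
            have := (X - B).le_opNorm (e k)
            rw [he.1 k, mul_one] at this
            rw [he.1 k, one_mul]
            exact this.trans hXB.le
          refine max_zero_sub_le_norm h2 ?_ (norm_nonneg _)
          have h3 : ((eigenvalues T k : ℝ) : ℂ) =
              ⟪e k, (X - B) (e k)⟫_ℂ - ⟪e k, (X - A) (e k)⟫_ℂ := by
            have h4 : X - B = T + (X - A) := by
              rw [← hAB]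
              abel
            rw [h4, add_apply, inner_add_right, add_sub_cancel_right, heT, inner_smul_right,
              inner_self_eq_norm_sq_to_K, he.1 k]
            simp
          have h5 : eigenvalues T k = ‖((eigenvalues T k : ℝ) : ℂ)‖ := by
            rw [Complex.norm_real, Real.norm_of_nonneg (h0 k)]
          rw [h5, h3]
          linarith [norm_sub_le ⟪e k, (X - B) (e k)⟫_ℂ ⟪e k, (X - A) (e k)⟫_ℂ]
        _ ≤ traceNorm (X - A) := tsum_enorm_inner_apply_le_traceNorm he _

end Operators

end EntropyNote

open EntropyNote
theorem mainTheorem2 :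
    -- probability sequences
    (∀ (𝕜 : Type*) [RCLike 𝕜] (ι : Type*) (ω : ι → ℝ), (∀ i, 0 ≤ ω i) → HasSum ω 1 →
      -- over `0 < r_1 < 1` the boundary of `U` is the curve `r_1 = ∑ max(0, ω_i - r_∞)`
      (∀ r₁ t : ℝ≥0, 0 < r₁ → r₁ < 1 →
        ((r₁, t) ∈ frontier (seqU 𝕜 ω) ↔ (r₁ : ℝ) = excess ω t)) ∧
      (∀ r₁ : ℝ≥0, 0 < r₁ → r₁ < 1 → ∃! t : ℝ≥0, (r₁, t) ∈ frontier (seqU 𝕜 ω)) ∧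
      -- the formula for the entropy, as an identity in `[-∞, ∞]`
      ((entropy ω : ℝ≥0∞) : EReal) = -boundaryLogIntegral (seqU 𝕜 ω) - 1 ∧
      -- the linear pieces of the curve and their contributions
      (∀ p ∈ consecutiveValues ω,
        excess ω p.1 < excess ω p.2 ∧
        (∀ r ∈ Ioo (excess ω p.1) (excess ω p.2),
          boundaryHeight (seqU 𝕜 ω) r = p.1 - (r - excess ω p.1) / countGE ω p.1) ∧
        IntervalIntegrable (fun r => Real.log (boundaryHeight (seqU 𝕜 ω) r)) volume
          (excess ω p.1) (excess ω p.2) ∧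
        -(∫ r in (excess ω p.1)..(excess ω p.2), Real.log (boundaryHeight (seqU 𝕜 ω) r)) =
          contribution ω p.1 p.2 ∧
        0 ≤ contribution ω p.1 p.2) ∧
      -- minus the integral is the sum of the contributions of the pieces
      -boundaryLogIntegral (seqU 𝕜 ω) =
        ((∑' p : consecutiveValues ω,
          ENNReal.ofReal (contribution ω p.1.1 p.1.2) : ℝ≥0∞) : EReal)) ∧
    -- positive trace-class operators of trace one on a separable Hilbert space
    (∀ (H : Type*) [NormedAddCommGroup H] [InnerProductSpace ℂ H] [CompleteSpace H]
      [TopologicalSpace.SeparableSpace H] (T : H →L[ℂ] H), T ∈ densityOperators H →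
      -- over `0 < r_1 < 1` the boundary of `U` is the curve `r_1 = ∑ max(0, ω_i - r_∞)`
      (∀ r₁ t : ℝ≥0, 0 < r₁ → r₁ < 1 →
        ((r₁, t) ∈ frontier (opU T) ↔ (r₁ : ℝ) = excess (eigenvalues T) t)) ∧
      (∀ r₁ : ℝ≥0, 0 < r₁ → r₁ < 1 → ∃! t : ℝ≥0, (r₁, t) ∈ frontier (opU T)) ∧
      -- the formula for the entropy, as an identity in `[-∞, ∞]`
      ((entropy (eigenvalues T) : ℝ≥0∞) : EReal) = -boundaryLogIntegral (opU T) - 1 ∧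
      -- the linear pieces of the curve and their contributions
      (∀ p ∈ consecutiveValues (eigenvalues T),
        excess (eigenvalues T) p.1 < excess (eigenvalues T) p.2 ∧
        (∀ r ∈ Ioo (excess (eigenvalues T) p.1) (excess (eigenvalues T) p.2),
          boundaryHeight (opU T) r = p.1 - (r - excess (eigenvalues T) p.1) / countGE (eigenvalues T) p.1) ∧
        IntervalIntegrable (fun r => Real.log (boundaryHeight (opU T) r)) volume
          (excess (eigenvalues T) p.1) (excess (eigenvalues T) p.2) ∧
        -(∫ r in (excess (eigenvalues T) p.1)..(excess (eigenvalues T) p.2), Real.log (boundaryHeight (opU T) r)) =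
          contribution (eigenvalues T) p.1 p.2 ∧
        0 ≤ contribution (eigenvalues T) p.1 p.2) ∧
      -- minus the integral is the sum of the contributions of the pieces
      -boundaryLogIntegral (opU T) =
        ((∑' p : consecutiveValues (eigenvalues T),
          ENNReal.ofReal (contribution (eigenvalues T) p.1.1 p.1.2) : ℝ≥0∞) : EReal)) := by
  refine ⟨fun 𝕜 _ ι ω h0 h1 => boundary_description h0 h1 (mem_seqU_iff h0 h1.summable),
    fun H _ _ _ _ T hT => ?_⟩
  obtain ⟨-, -, -, -, h0, h1⟩ := exists_isDiagonal_of_mem_densityOperators hT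
  exact boundary_description h0 h1 (mem_opU_iff hT)
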